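/- Let $(M^6,g)$ be a smooth Riemannian $6$-manifold with Levi-Civita connection $\nabla$, equipped with an $SU(3)$-structure: a smooth $g$-orthogonal almost complex structure $J$ with fundamental form $\omega(X,Y)=g(JX,Y)$, and a smooth complex $3$-form $\psi^{+}+i\psi^{-}$, such that every tangent space has an orthonormal basis $x_1,y_1,x_2,y_2,x_3,y_3$ with $Jx_a=y_a$ and $\psi^{+}+i\psi^{-}=dz_1\wedge dz_2\wedge dz_3$, where $dz_a=g(x_a,\cdot)+i\,g(y_a,\cdot)$ and $\alpha\wedge\beta=\alpha\otimes\beta-\beta\otimes\alpha$ for $1$-forms. Assume that $M$ is nearly Kähler, i.e. $$\nabla_X\omega=-X\lrcorner\psi^{+},\qquad \nabla_X\psi^{+}=X\wedge\omega \qquad\text{for all vector fields } X.$$ Let $R_{ijkl}=g(R(e_i,e_j)e_k,e_l)$, with $R(X,Y)=\nabla_X\nabla_Y-\nabla_Y\nabla_X-\nabla_{[X,Y]}$, be the components of the Riemann tensor in an orthonormal frame, and let $W$ be its Weyl part. For a tensor $A$ with the symmetries of a curvature tensor put, with summation over repeated indices, $$(\hat A\beta)_{ij}=A_{ijkl}\beta_{kl}\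 \ (\beta\in\Omega^2),\qquad (\mathring A h)_{ij}=A_{kilj}h_{kl}\ \ (h\in\mathcal S^2),\qquad (h\diamond\omega)_{ij}=h_{ip}\omega_{pj}+h_{jp}\omega_{ip}.$$ Let $\Omega^2_8$ be the bundle of primitive $2$-forms of type $(1,1)$ (the $J$-invariant $\beta$ with $\beta_{ij}\omega_{ij}=0$), and let $\mathcal S^2_{+0}$ be the bundle of traceless symmetric $2$-tensors commuting with $J$. Suppose that $\delta\le \bar R\le\Delta$ for real numbers $\delta,\Delta$, where $\bar R(X\wedge Y)=R(X,Y,Y,X)/\|X\wedge Y\|^2$ is the sectional curvature. Then, at every point of $M$: 1. $\hat R$ preserves $\Omega^2_8$, and every eigenvalue of $\hat R$ on $\Omega^2_8$ lies in both intervals $$\bigl[-4+(\Delta+\delta)-3(\Delta-\delta),\ -4+(\Delta+\delta)+3(\Delta-\delta)\bigr],\qquad \bigl[-(\Delta+\delta)-\tfrac73(\Delta-\delta),\ -(\Delta+\delta)+\tfrac73(\Delta-\delta)\bigr].$$ 2. $\hat W(h\diamond\omega)=2\,(\mathring W h)\diamond\omega$ for every $h\in\mathcal S^2_{+0}$. 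-/

import Mathlib

open scoped Manifold ContDiff Bundle
open Module

noncomputable section

namespace NearlyKahler

/-! ### Tensor algebra on a Euclidean vector space

Two-tensors are bilinear forms, four-tensors are functions of four vectors, and components are
taken in the orthonormal basis `stdOrthonormalBasis ℝ V`. -/

section Algebra

/-- The bilinear form with prescribed components in the standard orthonormal basis. -/
def ofComponents {V : Type*} [NormedAddCommGroup V] [InnerProductSpace ℝ V]
    [FiniteDimensional ℝ V] (c : Fin (finrank ℝ V) → Fin (finrank ℝ V) → ℝ) :
    LinearMap.BilinForm ℝ V :=
  Matrix.toBilin (stdOrthonormalBasis ℝ V).toBasis (Matrix.of c)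

/-- The operator `Â` of a four-tensor `A`: `(Âβ)_ij = A_ijkl β_kl`. -/
def hatOp {V : Type*} [NormedAddCommGroup V] [InnerProductSpace ℝ V]
    [FiniteDimensional ℝ V] (A : V → V → V → V → ℝ) :
    End ℝ (LinearMap.BilinForm ℝ V) where
  toFun β := ofComponents fun i j => ∑ k, ∑ l,
    A (stdOrthonormalBasis ℝ V i) (stdOrthonormalBasis ℝ V j)
      (stdOrthonormalBasis ℝ V k) (stdOrthonormalBasis ℝ V l) *
      β (stdOrthonormalBasis ℝ V k) (stdOrthonormalBasis ℝ V l)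
  map_add' β γ := by
    unfold ofComponents
    rw [← map_add]
    congr 1
    ext i j
    simp [mul_add, Finset.sum_add_distrib]
  map_smul' c β := by
    unfold ofComponents
    rw [RingHom.id_apply, ← map_smul]
    congr 1
    ext i j
    simp [Finset.mul_sum, mul_left_comm]

/-- The operator `Å` of a four-tensor `A`: `(Åh)_ij = A_kilj h_kl`. -/
def ringOp {V : Type*} [NormedAddCommGroup V] [InnerProductSpace ℝ V]
    [FiniteDimensional ℝ V] (A : V → V → V → V → ℝ) :
    End ℝ (LinearMap.BilinForm ℝ V) where
  toFun h := ofComponents fun i j => ∑ k, ∑ l,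
    A (stdOrthonormalBasis ℝ V k) (stdOrthonormalBasis ℝ V i)
      (stdOrthonormalBasis ℝ V l) (stdOrthonormalBasis ℝ V j) *
      h (stdOrthonormalBasis ℝ V k) (stdOrthonormalBasis ℝ V l)
  map_add' β γ := by
    unfold ofComponents
    rw [← map_add]
    congr 1
    ext i j
    simp [mul_add, Finset.sum_add_distrib]
  map_smul' c β := by
    unfold ofComponents
    rw [RingHom.id_apply, ← map_smul]
    congr 1
    ext i j
    simp [Finset.mul_sum, mul_left_comm]

/-- `(h ⋄ σ)_ij = h_ip σ_pj + h_jp σ_ip`. -/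
def diamond {V : Type*} [NormedAddCommGroup V] [InnerProductSpace ℝ V]
    [FiniteDimensional ℝ V] (h σ : LinearMap.BilinForm ℝ V) : LinearMap.BilinForm ℝ V :=
  ofComponents fun i j => ∑ p,
    (h (stdOrthonormalBasis ℝ V i) (stdOrthonormalBasis ℝ V p) *
        σ (stdOrthonormalBasis ℝ V p) (stdOrthonormalBasis ℝ V j) +
      h (stdOrthonormalBasis ℝ V j) (stdOrthonormalBasis ℝ V p) *
        σ (stdOrthonormalBasis ℝ V i) (stdOrthonormalBasis ℝ V p))

/-- The sectional curvature `A(u, v, v, u) / ‖u ∧ v‖²` of a four-tensor `A`. -/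
def sectional {V : Type*} [NormedAddCommGroup V] [InnerProductSpace ℝ V]
    (A : V → V → V → V → ℝ) (u v : V) : ℝ :=
  A u v v u / (‖u‖ ^ 2 * ‖v‖ ^ 2 - (inner ℝ u v) ^ 2)

/-- The Kulkarni–Nomizu product
`(s ∧ t)_ijkl = s_il t_jk + s_jk t_il - s_ik t_jl - s_jl t_ik`. -/
def kulkarniNomizu {V : Type*} (s t : V → V → ℝ) (a b c d : V) : ℝ :=
  s a d * t b c + s b c * t a d - s a c * t b d - s b d * t a c

/-- The Ricci contraction `Ric_ij = A_kijk`. -/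
def ricci {V : Type*} [NormedAddCommGroup V] [InnerProductSpace ℝ V]
    [FiniteDimensional ℝ V] (A : V → V → V → V → ℝ) (u v : V) : ℝ :=
  ∑ k, A (stdOrthonormalBasis ℝ V k) u v (stdOrthonormalBasis ℝ V k)

/-- The scalar contraction `Ric_ii`. -/
def scalar {V : Type*} [NormedAddCommGroup V] [InnerProductSpace ℝ V]
    [FiniteDimensional ℝ V] (A : V → V → V → V → ℝ) : ℝ :=
  ∑ i, ricci A (stdOrthonormalBasis ℝ V i) (stdOrthonormalBasis ℝ V i)

/-- The traceless Ricci tensor. -/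
def tracelessRicci {V : Type*} [NormedAddCommGroup V] [InnerProductSpace ℝ V]
    [FiniteDimensional ℝ V] (A : V → V → V → V → ℝ) (u v : V) : ℝ :=
  ricci A u v - scalar A / (finrank ℝ V : ℝ) * inner ℝ u v

/-- The Weyl part `A - (n - 2)⁻¹ Ric⁰ ∧ g - (2n(n - 1))⁻¹ scal g ∧ g` of a curvature tensor `A`
on a space of dimension `n ≥ 3`. -/
def weyl {V : Type*} [NormedAddCommGroup V] [InnerProductSpace ℝ V]
    [FiniteDimensional ℝ V] (A : V → V → V → V → ℝ) (a b c d : V) : ℝ :=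
  A a b c d
    - 1 / ((finrank ℝ V : ℝ) - 2) *
        kulkarniNomizu (tracelessRicci A) (fun u v => inner ℝ u v) a b c d
    - scalar A / (2 * (finrank ℝ V : ℝ) * ((finrank ℝ V : ℝ) - 1)) *
        kulkarniNomizu (fun u v => inner ℝ u v) (fun u v => inner ℝ u v) a b c d

/-- The fundamental form `ω(u, v) = ⟨J u, v⟩`. -/
def fundamentalForm {V : Type*} [NormedAddCommGroup V] [InnerProductSpace ℝ V]
    (J : V →ₗ[ℝ] V) : LinearMap.BilinForm ℝ V :=
  (innerₗ V) ∘ₗ J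

/-- `Λ²₈`: the primitive two-forms of type `(1,1)`, i.e. the alternating, `J`-invariant bilinear
forms `β` with `β_ij ω_ij = 0`. -/
def lambda28 {V : Type*} [NormedAddCommGroup V] [InnerProductSpace ℝ V]
    [FiniteDimensional ℝ V] (J : V →ₗ[ℝ] V) : Submodule ℝ (LinearMap.BilinForm ℝ V) where
  carrier := {β | β.IsAlt ∧ (∀ u v, β (J u) (J v) = β u v) ∧
    ∑ i, ∑ j, β (stdOrthonormalBasis ℝ V i) (stdOrthonormalBasis ℝ V j) *
      fundamentalForm J (stdOrthonormalBasis ℝ V i) (stdOrthonormalBasis ℝ V j) = 0}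
  add_mem' := by
    rintro β γ ⟨h1, h2, h3⟩ ⟨k1, k2, k3⟩
    refine ⟨h1.add k1, fun u v => ?_, ?_⟩
    · simp [h2, k2]
    · simp only [LinearMap.add_apply, add_mul, Finset.sum_add_distrib, h3, k3, add_zero]
  zero_mem' := by
    refine ⟨LinearMap.BilinForm.isAlt_zero, fun u v => ?_, ?_⟩ <;> simp
  smul_mem' := by
    rintro c β ⟨h1, h2, h3⟩
    refine ⟨h1.smul c, fun u v => ?_, ?_⟩
    · simp [h2]
    · simp only [LinearMap.smul_apply, smul_eq_mul, mul_assoc, ← Finset.mul_sum, h3, mul_zero]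

/-- `S²₊₀`: the symmetric traceless bilinear forms commuting with `J`. -/
structure IsSymPlusZero {V : Type*} [NormedAddCommGroup V] [InnerProductSpace ℝ V]
    [FiniteDimensional ℝ V] (J : V →ₗ[ℝ] V) (h : LinearMap.BilinForm ℝ V) : Prop where
  symm : ∀ u v, h u v = h v u
  commute : ∀ u v, h (J u) (J v) = h u v
  trace : ∑ i, h (stdOrthonormalBasis ℝ V i) (stdOrthonormalBasis ℝ V i) = 0

/-- The complex coordinate `z_a = x_a + i y_a` of an orthonormal basis `(x_1, y_1, x_2, y_2, …)`. -/
def complexCoord {V : Type*} [NormedAddCommGroup V] [InnerProductSpace ℝ V]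
    (e : OrthonormalBasis (Fin 3 × Fin 2) ℝ V) (a : Fin 3) (u : V) : ℂ :=
  (inner ℝ (e (a, 0)) u : ℝ) + Complex.I * (inner ℝ (e (a, 1)) u : ℝ)

/-- The value `dz₁ ∧ dz₂ ∧ dz₃ (u, v, w)`, with `α ∧ β = α ⊗ β - β ⊗ α` on one-forms. -/
def complexVolume {V : Type*} [NormedAddCommGroup V] [InnerProductSpace ℝ V]
    (e : OrthonormalBasis (Fin 3 × Fin 2) ℝ V) (u v w : V) : ℂ :=
  Matrix.det (Matrix.of fun a b : Fin 3 => complexCoord e a (![u, v, w] b))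

end Algebra

/-! ### Riemannian manifolds -/

section Manifold

/-! The manifold `M` is modelled on a finite-dimensional real vector space `E` (of dimension 6 in
the main theorem). -/

instance instFiniteDimensionalTangent {E : Type*} [NormedAddCommGroup E] [NormedSpace ℝ E]
    [FiniteDimensional ℝ E] {M : Type*} [TopologicalSpace M] [ChartedSpace E M] (x : M) :
    FiniteDimensional ℝ (TangentSpace 𝓘(ℝ, E) x) :=
  inferInstanceAs (FiniteDimensional ℝ E)

/-- `∇` is the Levi-Civita connection: a smooth connection on the tangent bundle that is metric
and torsion free. -/
structure IsLeviCivita {E : Type*} [NormedAddCommGroup E] [NormedSpace ℝ E]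
    [FiniteDimensional ℝ E] {M : Type*} [TopologicalSpace M] [ChartedSpace E M]
    [IsManifold 𝓘(ℝ, E) ∞ M] [Bundle.RiemannianBundle (fun x : M => TangentSpace 𝓘(ℝ, E) x)]
    [IsContMDiffRiemannianBundle 𝓘(ℝ, E) ∞ E (fun x : M => TangentSpace 𝓘(ℝ, E) x)]
    (cov : CovariantDerivative 𝓘(ℝ, E) E (fun x : M => TangentSpace 𝓘(ℝ, E) x)) : Prop where
  smooth : CovariantDerivative.ContMDiffCovariantDerivative cov ∞
  metric : ∀ (x : M) (u : TangentSpace 𝓘(ℝ, E) x) (Y Z : Π y : M, TangentSpace 𝓘(ℝ, E) y),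
    MDiffAt (T% Y) x → MDiffAt (T% Z) x →
    d% (fun y => (inner ℝ (Y y) (Z y) : ℝ)) x u =
      inner ℝ (cov Y x u) (Z x) + inner ℝ (Y x) (cov Z x u)
  torsionFree : cov.torsion = 0

/-- The curvature `R(u, v) w = ∇_X ∇_Y Z - ∇_Y ∇_X Z - ∇_[X,Y] Z` at `x`, where `X, Y, Z` are
vector fields, smooth near `x`, with values `u, v, w` at `x`. -/
def curvature {E : Type*} [NormedAddCommGroup E] [NormedSpace ℝ E]
    [FiniteDimensional ℝ E] {M : Type*} [TopologicalSpace M] [ChartedSpace E M]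
    [IsManifold 𝓘(ℝ, E) ∞ M]
    (cov : CovariantDerivative 𝓘(ℝ, E) E (fun x : M => TangentSpace 𝓘(ℝ, E) x))
    (x : M) (u v w : TangentSpace 𝓘(ℝ, E) x) : TangentSpace 𝓘(ℝ, E) x :=
  let X : Π y : M, TangentSpace 𝓘(ℝ, E) y := FiberBundle.extend E u
  let Y : Π y : M, TangentSpace 𝓘(ℝ, E) y := FiberBundle.extend E v
  let Z : Π y : M, TangentSpace 𝓘(ℝ, E) y := FiberBundle.extend E w
  cov (fun y => cov Z y (Y y)) x (X x) - cov (fun y => cov Z y (X y)) x (Y x)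
    - cov Z x (VectorField.mlieBracket 𝓘(ℝ, E) X Y x)

/-- The Riemann tensor `Riem(u, v, w, z) = ⟨R(u, v) w, z⟩`, so that the sectional curvature of an
orthonormal pair is `Riem(u, v, v, u)`. -/
def riem {E : Type*} [NormedAddCommGroup E] [NormedSpace ℝ E]
    [FiniteDimensional ℝ E] {M : Type*} [TopologicalSpace M] [ChartedSpace E M]
    [IsManifold 𝓘(ℝ, E) ∞ M] [Bundle.RiemannianBundle (fun x : M => TangentSpace 𝓘(ℝ, E) x)]
    (cov : CovariantDerivative 𝓘(ℝ, E) E (fun x : M => TangentSpace 𝓘(ℝ, E) x))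
    (x : M) (u v w z : TangentSpace 𝓘(ℝ, E) x) : ℝ :=
  inner ℝ (curvature cov x u v w) z

variable (E : Type*) [NormedAddCommGroup E] [NormedSpace ℝ E] [FiniteDimensional ℝ E]
    (M : Type*) [TopologicalSpace M] [ChartedSpace E M]
    [IsManifold 𝓘(ℝ, E) ∞ M] [Bundle.RiemannianBundle (fun x : M => TangentSpace 𝓘(ℝ, E) x)] in
/-- An `SU(3)`-structure compatible with the metric: an almost complex structure `J` and a complex
three-form `ψ⁺ + iψ⁻`, both smooth (tested on smooth vector fields), which at every point take the standard form in some
orthonormal basis `x₁, y₁, x₂, y₂, x₃, y₃` of the tangent space: `J x_a = y_a`, `J y_a = -x_a` and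
`ψ⁺ + iψ⁻ = dz₁ ∧ dz₂ ∧ dz₃`. -/
structure SU3Structure where
  J : Π x : M, TangentSpace 𝓘(ℝ, E) x →ₗ[ℝ] TangentSpace 𝓘(ℝ, E) x
  psiPlus : Π x : M, TangentSpace 𝓘(ℝ, E) x →ₗ[ℝ] TangentSpace 𝓘(ℝ, E) x →ₗ[ℝ]
    TangentSpace 𝓘(ℝ, E) x →ₗ[ℝ] ℝ
  psiMinus : Π x : M, TangentSpace 𝓘(ℝ, E) x →ₗ[ℝ] TangentSpace 𝓘(ℝ, E) x →ₗ[ℝ]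
    TangentSpace 𝓘(ℝ, E) x →ₗ[ℝ] ℝ
  smooth_J : ∀ (x : M) (Y : Π y : M, TangentSpace 𝓘(ℝ, E) y),
    CMDiffAt ∞ (T% Y) x → CMDiffAt ∞ (T% (fun y => J y (Y y))) x
  smooth_psiPlus : ∀ (x : M) (Y Z W : Π y : M, TangentSpace 𝓘(ℝ, E) y),
    CMDiffAt ∞ (T% Y) x → CMDiffAt ∞ (T% Z) x → CMDiffAt ∞ (T% W) x →
    CMDiffAt ∞ (fun y => psiPlus y (Y y) (Z y) (W y)) x
  smooth_psiMinus : ∀ (x : M) (Y Z W : Π y : M, TangentSpace 𝓘(ℝ, E) y),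
    CMDiffAt ∞ (T% Y) x → CMDiffAt ∞ (T% Z) x → CMDiffAt ∞ (T% W) x →
    CMDiffAt ∞ (fun y => psiMinus y (Y y) (Z y) (W y)) x
  adapted : ∀ x : M, ∃ e : OrthonormalBasis (Fin 3 × Fin 2) ℝ (TangentSpace 𝓘(ℝ, E) x),
    (∀ a, J x (e (a, 0)) = e (a, 1)) ∧ (∀ a, J x (e (a, 1)) = -e (a, 0)) ∧
    (∀ u v w, psiPlus x u v w = (complexVolume e u v w).re) ∧
    (∀ u v w, psiMinus x u v w = (complexVolume e u v w).im)

/-- The form `ω = ⟨J ·, ·⟩` of an `SU(3)`-structure. -/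
def SU3Structure.omega {E : Type*} [NormedAddCommGroup E] [NormedSpace ℝ E]
    [FiniteDimensional ℝ E] {M : Type*} [TopologicalSpace M] [ChartedSpace E M]
    [IsManifold 𝓘(ℝ, E) ∞ M] [Bundle.RiemannianBundle (fun x : M => TangentSpace 𝓘(ℝ, E) x)]
    (S : SU3Structure E M) (x : M) : LinearMap.BilinForm ℝ (TangentSpace 𝓘(ℝ, E) x) :=
  fundamentalForm (S.J x)

/-- The nearly Kähler condition `∇_u ω = -u ⌟ ψ⁺`, `∇_u ψ⁺ = u ∧ ω`. Both equations are evaluated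
on arbitrary vector fields differentiable at the point under consideration. -/
structure IsNearlyKahler {E : Type*} [NormedAddCommGroup E] [NormedSpace ℝ E]
    [FiniteDimensional ℝ E] {M : Type*} [TopologicalSpace M] [ChartedSpace E M]
    [IsManifold 𝓘(ℝ, E) ∞ M] [Bundle.RiemannianBundle (fun x : M => TangentSpace 𝓘(ℝ, E) x)]
    (cov : CovariantDerivative 𝓘(ℝ, E) E (fun x : M => TangentSpace 𝓘(ℝ, E) x))
    (S : SU3Structure E M) : Prop where
  nabla_omega : ∀ (x : M) (u : TangentSpace 𝓘(ℝ, E) x) (Y Z : Π y : M, TangentSpace 𝓘(ℝ, E) y),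
    MDiffAt (T% Y) x → MDiffAt (T% Z) x →
    d% (fun y => S.omega y (Y y) (Z y)) x u
        - S.omega x (cov Y x u) (Z x) - S.omega x (Y x) (cov Z x u) =
      -S.psiPlus x u (Y x) (Z x)
  nabla_psiPlus : ∀ (x : M) (u : TangentSpace 𝓘(ℝ, E) x) (Y Z W : Π y : M, TangentSpace 𝓘(ℝ, E) y),
    MDiffAt (T% Y) x → MDiffAt (T% Z) x → MDiffAt (T% W) x →
    d% (fun y => S.psiPlus y (Y y) (Z y) (W y)) x u
        - S.psiPlus x (cov Y x u) (Z x) (W x) - S.psiPlus x (Y x) (cov Z x u) (W x)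
        - S.psiPlus x (Y x) (Z x) (cov W x u) =
      inner ℝ u (Y x) * S.omega x (Z x) (W x) + inner ℝ u (Z x) * S.omega x (W x) (Y x)
        + inner ℝ u (W x) * S.omega x (Y x) (Z x)

end Manifold

end NearlyKahler

end

/-! The curvature of a nearly Kähler 6-manifold with this normalisation is R = S + K, where S is the
curvature tensor of the unit sphere and K takes values in 𝔰𝔲(3). Indeed, differentiating `ω` twice
uses ∇ω = -ψ⁺ and then ∇ψ⁺ = · ∧ ω, so the curvature operators act on `ω`, and likewise on ψ⁺,
exactly as those of the sphere do (`curvature_omega`, `curvature_psiPlus`). Hence K annihilates `ω`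
and ψ⁺, which makes it J-invariant and trace-free in its last pair (`isCalabiYauType_of_adapted`).
The rest is linear algebra in one tangent space.

Like the curvature of a Calabi–Yau metric, K is Ricci-flat, so K is the Weyl tensor of R. The
statement on W is then a Kähler identity for K, a consequence of Bianchi and J-invariance
(`apply_map_right`). On 2-forms R̂ = K̂ - 2, and the image of K̂ lies in Λ²₈, so R̂ preserves Λ²₈.

For the eigenvalues, β in Λ²₈ is diagonalised as ∑ c_a f_a ∧ Jf_a with ∑ c_a = 0. On the plane with
the largest |c_a| the eigenvalue equation reads μ = 2(-sec - s·m - t·m'), where sec is the sectional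
curvature of the plane, s, t are convex weights and m, m' are mixed components R(f_a, Jf_a, f_b,
Jf_b). These components are bounded in two ways: by 2 minus two sectional curvatures
(`apply_map_map`), which gives the first interval, and by Berger's estimate, which gives the second.
-/

noncomputable section

namespace NearlyKahler

/-! ### Multilinear algebra: curvature symmetries, basis-free traces, evaluation of the operators.
-/

section PointwiseAlgebra

/-! ### Curvature tensors -/

/-- The first three symmetries of a curvature tensor. -/
structure IsCurvatureLike {V : Type*} (A : V → V → V → V → ℝ) : Prop where
  skew_left : ∀ u v w z, A u v w z = -A v u w z
  skew_right : ∀ u v w z, A u v w z = -A u v z w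
  bianchi : ∀ u v w z, A u v w z + A v w u z + A w u v z = 0

namespace IsCurvatureLike

variable {V : Type*} {A : V → V → V → V → ℝ} (hA : IsCurvatureLike A)
include hA

/-- The classical octahedron argument: the four cyclic shifts of Bianchi are combined, and modulo
the two skew symmetries all other terms cancel. -/
lemma pair_symm (u v w z : V) : A u v w z = A w z u v := by
  linarith [hA.bianchi u v w z, hA.bianchi v w z u, hA.bianchi w z u v, hA.bianchi z u v w,
    hA.skew_left u v w z, hA.skew_left w z u v, hA.skew_right u v w z, hA.skew_right w z u v,
    hA.skew_left v w u z, hA.skew_right v w u z, hA.skew_left w u v z, hA.skew_right w u v z,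
    hA.skew_left v w z u, hA.skew_right v w z u, hA.skew_left w z v u, hA.skew_right w z v u,
    hA.skew_left z v w u, hA.skew_right z v w u,
    hA.skew_left z u w v, hA.skew_right z u w v, hA.skew_left u w z v, hA.skew_right u w z v,
    hA.skew_left u v z w, hA.skew_right u v z w, hA.skew_left v z u w, hA.skew_right v z u w,
    hA.skew_left z u v w, hA.skew_right z u v w]

lemma self_left (u w z : V) : A u u w z = 0 := by linarith [hA.skew_left u u w z]

end IsCurvatureLike

variable {V : Type*} [NormedAddCommGroup V] [InnerProductSpace ℝ V]

/-! ### Sums over orthonormal bases -/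

lemma sum_inner_mul_apply {ι : Type*} [Fintype ι] (b : OrthonormalBasis ι ℝ V)
    (f : V →ₗ[ℝ] ℝ) (u : V) : ∑ i, inner ℝ u (b i) * f (b i) = f u := by
  conv_rhs => rw [← b.sum_repr' u]
  simp [map_sum, real_inner_comm]

/-- Expanding one argument of each side in the other basis yields the same double sum of ⟨b i, c j⟩
B(b i, c j). -/
lemma sum_apply_apply_eq {ι κ : Type*} [Fintype ι] [Fintype κ] (b : OrthonormalBasis ι ℝ V)
    (c : OrthonormalBasis κ ℝ V) (B : V →ₗ[ℝ] V →ₗ[ℝ] ℝ) :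
    ∑ i, B (b i) (b i) = ∑ j, B (c j) (c j) := by
  have h1 : ∀ i, B (b i) (b i) = ∑ j, inner ℝ (b i) (c j) * B (b i) (c j) := fun i =>
    (sum_inner_mul_apply c (B (b i)) (b i)).symm
  have h2 : ∀ j, B (c j) (c j) = ∑ i, inner ℝ (c j) (b i) * B (b i) (c j) := fun j =>
    (sum_inner_mul_apply b (B.flip (c j)) (c j)).symm
  simp_rw [h1, h2]
  rw [Finset.sum_comm]
  simp_rw [real_inner_comm]

lemma sum_sum_mul_eq {ι κ : Type*} [Fintype ι] [Fintype κ] (b : OrthonormalBasis ι ℝ V)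
    (c : OrthonormalBasis κ ℝ V) (P Q : V →ₗ[ℝ] V →ₗ[ℝ] ℝ) :
    ∑ i, ∑ j, P (b i) (b j) * Q (b i) (b j) = ∑ i, ∑ j, P (c i) (c j) * Q (c i) (c j) := by
  have h1 : ∀ i, ∑ j, P (b i) (b j) * Q (b i) (b j) = ∑ j, P (b i) (c j) * Q (b i) (c j) :=
    fun i => sum_apply_apply_eq b c
      (LinearMap.mk₂ ℝ (fun x y => P (b i) x * Q (b i) y) (by intros; simp; ring)
        (by intros; simp; ring) (by intros; simp; ring) (by intros; simp; ring))
  have h2 : ∀ j, ∑ i, P (b i) (c j) * Q (b i) (c j) = ∑ i, P (c i) (c j) * Q (c i) (c j) :=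
    fun j => sum_apply_apply_eq b c
      (LinearMap.mk₂ ℝ (fun x y => P x (c j) * Q y (c j)) (by intros; simp; ring)
        (by intros; simp; ring) (by intros; simp; ring) (by intros; simp; ring))
  simp_rw [h1]
  rw [Finset.sum_comm]
  simp_rw [h2]
  rw [Finset.sum_comm]

/-- `J` is an orthogonal complex structure. -/
structure IsOrthogonalComplex (J : V →ₗ[ℝ] V) : Prop where
  sq : ∀ u, J (J u) = -u
  inner_map_map : ∀ u v, inner ℝ (J u) (J v) = (inner ℝ u v : ℝ)

namespace IsOrthogonalComplex

variable {J : V →ₗ[ℝ] V} (hJ : IsOrthogonalComplex J)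
include hJ

lemma inner_map_left (u v : V) : (inner ℝ (J u) v : ℝ) = -inner ℝ u (J v) := by
  have := hJ.inner_map_map u (J v)
  rw [hJ.sq, inner_neg_right] at this
  linarith

lemma inner_map_self (u : V) : (inner ℝ (J u) u : ℝ) = 0 := by
  have := hJ.inner_map_left u u
  rw [real_inner_comm] at this ⊢
  linarith

/-- `J` as a linear isometric equivalence. -/
def isometryEquiv (hJ : IsOrthogonalComplex J) : V ≃ₗᵢ[ℝ] V :=
  LinearEquiv.isometryOfInner
    (LinearEquiv.ofLinearMap J (-J) (by ext; simp [hJ.sq]) (by ext; simp [hJ.sq]))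
    (fun u v => hJ.inner_map_map u v)

/-- `J` carries `b` to another orthonormal basis. Computing the trace of B(·, J·) there produces `J
(J (b i))`, hence the sign. -/
lemma sum_apply_map {ι : Type*} [Fintype ι] (b : OrthonormalBasis ι ℝ V)
    (B : V →ₗ[ℝ] V →ₗ[ℝ] ℝ) : ∑ i, B (b i) (J (b i)) = -∑ i, B (J (b i)) (b i) := by
  have h := sum_apply_apply_eq b (b.map hJ.isometryEquiv) (B.compl₂ J)
  simp only [OrthonormalBasis.map_apply, LinearMap.compl₂_apply] at h
  have h' : ∀ u, hJ.isometryEquiv u = J u := fun u => rfl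
  simpa [h', hJ.sq] using h

lemma sum_map_map {ι : Type*} [Fintype ι] (b : OrthonormalBasis ι ℝ V)
    (B : V →ₗ[ℝ] V →ₗ[ℝ] ℝ) : ∑ i, B (J (b i)) (J (b i)) = ∑ i, B (b i) (b i) :=
  (sum_apply_apply_eq b (b.map hJ.isometryEquiv) B).symm

end IsOrthogonalComplex

namespace IsCurvatureLike

variable {A : V → V → V → V → ℝ}

/-- A curvature-like function that is linear in its last argument is multilinear. -/
def toMultilinear (hA : IsCurvatureLike A)
    (hadd : ∀ u v w z z', A u v w (z + z') = A u v w z + A u v w z')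
    (hsmul : ∀ (c : ℝ) u v w z, A u v w (c • z) = c * A u v w z) :
    V →ₗ[ℝ] V →ₗ[ℝ] V →ₗ[ℝ] V →ₗ[ℝ] ℝ :=
  have add3 : ∀ u v w w' z, A u v (w + w') z = A u v w z + A u v w' z := fun u v w w' z => by
    rw [hA.skew_right, hadd, hA.skew_right u v w z, hA.skew_right u v w' z]; ring
  have smul3 : ∀ (c : ℝ) u v w z, A u v (c • w) z = c * A u v w z := fun c u v w z => by
    rw [hA.skew_right, hsmul, hA.skew_right u v w z]; ring
  LinearMap.mk₂ ℝ
    (fun u v => LinearMap.mk₂ ℝ (fun w z => A u v w z) (fun w w' z => add3 u v w w' z)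
      (fun c w z => smul3 c u v w z) (fun w z z' => hadd u v w z z')
      (fun c w z => hsmul c u v w z))
    -- Pair symmetry transports linearity from the last two slots to the first two.
    (fun u u' v => by
      ext w z; simp only [LinearMap.mk₂_apply, LinearMap.add_apply]
      rw [hA.pair_symm, add3, hA.pair_symm w z u v, hA.pair_symm w z u' v])
    (fun c u v => by
      ext w z; simp only [LinearMap.mk₂_apply, LinearMap.smul_apply, smul_eq_mul]
      rw [hA.pair_symm, smul3, hA.pair_symm w z u v])
    (fun u v v' => by
      ext w z; simp only [LinearMap.mk₂_apply, LinearMap.add_apply]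
      rw [hA.pair_symm, hadd, hA.pair_symm w z u v, hA.pair_symm w z u v'])
    (fun c u v => by
      ext w z; simp only [LinearMap.mk₂_apply, LinearMap.smul_apply, smul_eq_mul]
      rw [hA.pair_symm, hsmul, hA.pair_symm w z u v])

end IsCurvatureLike

/-- The curvature tensor of the unit sphere. -/
def sphereTensor (u v w z : V) : ℝ :=
  inner ℝ v w * inner ℝ u z - inner ℝ u w * inner ℝ v z

lemma isCurvatureLike_sphereTensor : IsCurvatureLike (sphereTensor (V := V)) where
  skew_left u v w z := by unfold sphereTensor; ring
  skew_right u v w z := by unfold sphereTensor; ring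
  bianchi u v w z := by
    unfold sphereTensor
    rw [real_inner_comm v w, real_inner_comm u w, real_inner_comm u v]; ring

/-! ### Evaluation of the operators -/

variable [FiniteDimensional ℝ V]

/-- This frees the operators, which are defined by components, from the standard basis: their value
on any two vectors is read off from a bilinear expression. -/
lemma ofComponents_apply_of_bilinear (B : V →ₗ[ℝ] V →ₗ[ℝ] ℝ) :
    ofComponents (fun i j => B (stdOrthonormalBasis ℝ V i) (stdOrthonormalBasis ℝ V j)) = B := by
  unfold ofComponents
  refine LinearMap.BilinForm.ext_basis (stdOrthonormalBasis ℝ V).toBasis fun i j => ?_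
  rw [Matrix.toBilin_apply]
  simp [OrthonormalBasis.coe_toBasis_repr_apply]

/-- The contraction does not depend on the orthonormal basis; the freedom in `b` is needed later,
when `β` is put into normal form. -/
lemma hatOp_apply (T : V →ₗ[ℝ] V →ₗ[ℝ] V →ₗ[ℝ] V →ₗ[ℝ] ℝ) (β : LinearMap.BilinForm ℝ V)
    {ι : Type*} [Fintype ι] (b : OrthonormalBasis ι ℝ V) (u v : V) :
    hatOp (fun u v w z => T u v w z) β u v = ∑ k, ∑ l, T u v (b k) (b l) * β (b k) (b l) := by
  have : hatOp (fun u v w z => T u v w z) β = LinearMap.mk₂ ℝ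
      (fun u v => ∑ k, ∑ l, T u v (b k) (b l) * β (b k) (b l))
      (by intros; simp [add_mul, Finset.sum_add_distrib])
      (by intros; simp [Finset.mul_sum, mul_assoc])
      (by intros; simp [add_mul, Finset.sum_add_distrib])
      (by intros; simp [Finset.mul_sum, mul_assoc]) := by
    rw [← ofComponents_apply_of_bilinear (LinearMap.mk₂ ℝ _ _ _ _ _)]
    simp only [LinearMap.mk₂_apply]
    change ofComponents _ = _
    congr 1
    ext i j
    exact sum_sum_mul_eq _ b (T _ _) β
  rw [this, LinearMap.mk₂_apply]

lemma ringOp_apply (T : V →ₗ[ℝ] V →ₗ[ℝ] V →ₗ[ℝ] V →ₗ[ℝ] ℝ) (h : LinearMap.BilinForm ℝ V)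
    (u v : V) :
    ringOp (fun u v w z => T u v w z) h u v =
      ∑ k, ∑ l, T (stdOrthonormalBasis ℝ V k) u (stdOrthonormalBasis ℝ V l) v *
        h (stdOrthonormalBasis ℝ V k) (stdOrthonormalBasis ℝ V l) := by
  set b := stdOrthonormalBasis ℝ V
  have : ringOp (fun u v w z => T u v w z) h = LinearMap.mk₂ ℝ
      (fun u v => ∑ k, ∑ l, T (b k) u (b l) v * h (b k) (b l))
      (by intros; simp [add_mul, Finset.sum_add_distrib])
      (by intros; simp [Finset.mul_sum, mul_assoc])
      (by intros; simp [add_mul, Finset.sum_add_distrib])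
      (by intros; simp [Finset.mul_sum, mul_assoc]) := by
    rw [← ofComponents_apply_of_bilinear (LinearMap.mk₂ ℝ _ _ _ _ _)]
    rfl
  rw [this, LinearMap.mk₂_apply]

/-- Contracting with `ω` inserts `J` into the free slot, with a sign when the contracted index is
the first one of `ω`. -/
lemma diamond_fundamentalForm_apply {J : V →ₗ[ℝ] V} (hJ : IsOrthogonalComplex J)
    (h : LinearMap.BilinForm ℝ V) (u v : V) :
    diamond h (fundamentalForm J) u v = h v (J u) - h u (J v) := by
  set b := stdOrthonormalBasis ℝ V
  have : diamond h (fundamentalForm J) = LinearMap.mk₂ ℝ (fun u v => h v (J u) - h u (J v))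
      (by intros; simp; ring) (by intros; simp; ring) (by intros; simp; ring)
      (by intros; simp; ring) := by
    rw [← ofComponents_apply_of_bilinear (LinearMap.mk₂ ℝ _ _ _ _ _)]
    simp only [LinearMap.mk₂_apply]
    unfold diamond
    congr 1
    ext i j
    have e1 : ∀ p, h (b i) (b p) * fundamentalForm J (b p) (b j) =
        -(inner ℝ (J (b j)) (b p) * h (b i) (b p)) := fun p => by
      change _ * inner ℝ (J (b p)) (b j) = _
      rw [hJ.inner_map_left, real_inner_comm]; ring
    have e2 : ∀ p, h (b j) (b p) * fundamentalForm J (b i) (b p) =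
        inner ℝ (J (b i)) (b p) * h (b j) (b p) := fun p => by
      change _ * inner ℝ (J (b i)) (b p) = _
      ring
    change ∑ p, (h (b i) (b p) * fundamentalForm J (b p) (b j) +
      h (b j) (b p) * fundamentalForm J (b i) (b p)) = h (b j) (J (b i)) - h (b i) (J (b j))
    simp_rw [e1, e2]
    rw [Finset.sum_add_distrib, Finset.sum_neg_distrib, sum_inner_mul_apply b (h (b i)),
      sum_inner_mul_apply b (h (b j))]
    ring
  rw [this, LinearMap.mk₂_apply]

end PointwiseAlgebra

section CalabiYauCurvature

variable {V : Type*} [NormedAddCommGroup V] [InnerProductSpace ℝ V] [FiniteDimensional ℝ V]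

/-! ### Curvature tensors of Calabi–Yau type -/

/-- Curvature tensors with values in `𝔰𝔲(V, J)`. -/
structure IsCalabiYauType (J : V →ₗ[ℝ] V) (K : V →ₗ[ℝ] V →ₗ[ℝ] V →ₗ[ℝ] V →ₗ[ℝ] ℝ) : Prop where
  curvatureLike : IsCurvatureLike (fun u v w z => K u v w z)
  map_map_right : ∀ u v w z, K u v (J w) (J z) = K u v w z
  trace_right : ∀ u v, ∑ i, K u v (stdOrthonormalBasis ℝ V i) (J (stdOrthonormalBasis ℝ V i)) = 0

namespace IsCalabiYauType

variable {J : V →ₗ[ℝ] V} {K : V →ₗ[ℝ] V →ₗ[ℝ] V →ₗ[ℝ] V →ₗ[ℝ] ℝ}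

lemma skew_left (hK : IsCalabiYauType J K) (u v w z : V) : K u v w z = -K v u w z :=
  hK.curvatureLike.skew_left u v w z

lemma skew_right (hK : IsCalabiYauType J K) (u v w z : V) : K u v w z = -K u v z w :=
  hK.curvatureLike.skew_right u v w z

lemma bianchi (hK : IsCalabiYauType J K) (u v w z : V) :
    K u v w z + K v w u z + K w u v z = 0 :=
  hK.curvatureLike.bianchi u v w z

lemma pair_symm (hK : IsCalabiYauType J K) (u v w z : V) : K u v w z = K w z u v :=
  hK.curvatureLike.pair_symm u v w z

lemma map_map_left (hK : IsCalabiYauType J K) (u v w z : V) : K (J u) (J v) w z = K u v w z := by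
  rw [hK.pair_symm, hK.map_map_right, hK.pair_symm]

lemma map_left_right (hK : IsCalabiYauType J K) (hJ : IsOrthogonalComplex J) (u v w z : V) :
    K u v (J w) z = -K u v w (J z) := by
  rw [← hK.map_map_right u v (J w) z, hJ.sq]; simp

lemma map_left_left (hK : IsCalabiYauType J K) (hJ : IsOrthogonalComplex J) (u v w z : V) :
    K (J u) v w z = -K u (J v) w z := by
  rw [hK.pair_symm, hK.map_left_right hJ, hK.pair_symm]

/-- Bianchi, followed by moving `J` across the last pair. This identity underlies both the
intertwining of `K̂` with `K̊` and the formula for mixed components. -/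
lemma apply_map_right (hK : IsCalabiYauType J K) (hJ : IsOrthogonalComplex J) (u v w z : V) :
    K u v w (J z) = K w v z (J u) - K w u z (J v) := by
  have h1 := hK.bianchi u v w (J z)
  have h2 := hK.skew_left v w u (J z)
  have h3 := hK.map_left_right hJ w v u z
  have h4 := hK.skew_right w v (J u) z
  have h5 := hK.map_left_right hJ w u v z
  have h6 := hK.skew_right w u (J v) z
  linarith

/-- Kähler geometry: by Bianchi and J-invariance, the J-trace of K(u, Jv, ·, ·) over its last pair
is -2 Ric(u, v), and that trace vanishes. -/
lemma ricci_eq_zero (hK : IsCalabiYauType J K) (hJ : IsOrthogonalComplex J) (u v : V) :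
    ricci (fun u v w z => K u v w z) u v = 0 := by
  set b := stdOrthonormalBasis ℝ V
  change ∑ k, K (b k) u v (b k) = 0
  have h1 : ∀ k, K u (J v) (b k) (J (b k)) =
      -K (b k) u v (b k) - K (J (b k)) v u (J (b k)) := fun k => by
    have e1 := hK.bianchi (b k) u (J v) (J (b k))
    have e2 := hK.map_map_right (b k) u v (b k)
    have e3 := hK.map_left_left hJ (b k) v u (J (b k))
    have e4 := hK.skew_left (b k) (J v) u (J (b k))
    linarith
  have h2 : ∀ k, K (b k) v u (b k) = K (b k) u v (b k) := fun k => by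
    rw [hK.pair_symm, hK.skew_left, hK.skew_right]; ring
  have h3 := hJ.sum_map_map b (LinearMap.mk₂ ℝ (fun x y => K x v u y)
    (by intros; simp) (by intros; simp) (by intros; simp) (by intros; simp))
  simp only [LinearMap.mk₂_apply, h2] at h3
  have h4 := hK.trace_right u (J v)
  change ∑ i, K u (J v) (b i) (J (b i)) = 0 at h4
  simp_rw [h1] at h4
  rw [Finset.sum_sub_distrib, Finset.sum_neg_distrib, h3] at h4
  linarith

/-- `K̂` intertwines with `K̊` under `h ↦ h ⋄ ω`. -/
lemma hatOp_diamond (hK : IsCalabiYauType J K) (hJ : IsOrthogonalComplex J)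
    (h : LinearMap.BilinForm ℝ V) :
    hatOp (fun u v w z => K u v w z) (diamond h (fundamentalForm J)) =
      (2 : ℝ) • diamond (ringOp (fun u v w z => K u v w z) h) (fundamentalForm J) := by
  set b := stdOrthonormalBasis ℝ V
  refine LinearMap.ext fun u => LinearMap.ext fun v => ?_
  rw [hatOp_apply K _ b]
  simp only [LinearMap.smul_apply, smul_eq_mul, diamond_fundamentalForm_apply hJ, ringOp_apply]
  -- Both halves of `h ⋄ ω` lead to one sum: `J` moves from `h` to `K` at the cost of a sign, and in
  -- the transposed half the skewness of `K` undoes that sign.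
  have e1 : ∑ k, ∑ l, K u v (b k) (b l) * h (b l) (J (b k)) =
      ∑ k, ∑ l, K u v (b k) (J (b l)) * h (b k) (b l) := by
    rw [Finset.sum_comm]
    refine Finset.sum_congr rfl fun k _ => ?_
    have := hJ.sum_apply_map b (LinearMap.mk₂ ℝ (fun x y => K u v x (b k) * h (b k) y)
      (by intros; simp; ring) (by intros; simp; ring) (by intros; simp; ring)
      (by intros; simp; ring))
    simp only [LinearMap.mk₂_apply] at this
    rw [this, ← Finset.sum_neg_distrib]
    refine Finset.sum_congr rfl fun l _ => ?_
    rw [hK.skew_right]; ring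
  have e2 : ∑ k, ∑ l, K u v (b k) (b l) * h (b k) (J (b l)) =
      -∑ k, ∑ l, K u v (b k) (J (b l)) * h (b k) (b l) := by
    rw [← Finset.sum_neg_distrib]
    refine Finset.sum_congr rfl fun k _ => ?_
    exact hJ.sum_apply_map b (LinearMap.mk₂ ℝ (fun x y => K u v (b k) x * h (b k) y)
      (by intros; simp; ring) (by intros; simp; ring) (by intros; simp; ring)
      (by intros; simp; ring))
  have e3 : ∑ k, ∑ l, K u v (b k) (b l) * (h (b l) (J (b k)) - h (b k) (J (b l))) =
      2 * ∑ k, ∑ l, K u v (b k) (J (b l)) * h (b k) (b l) := by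
    simp only [mul_sub, Finset.sum_sub_distrib]
    rw [e1, e2]; ring
  rw [e3, ← Finset.sum_sub_distrib]
  congr 1
  refine Finset.sum_congr rfl fun k _ => ?_
  rw [← Finset.sum_sub_distrib]
  refine Finset.sum_congr rfl fun l _ => ?_
  -- The identity splits each summand into the two terms of `K̊h ⋄ ω`.
  rw [hK.apply_map_right hJ]; ring

/-- Pair symmetry gives the first pair of `K` the properties of the last: skewness, J-invariance and
vanishing J-trace. So the image lies in Λ²₈ whatever `β` is. -/
lemma hatOp_mem_lambda28 (hK : IsCalabiYauType J K)
    (β : LinearMap.BilinForm ℝ V) : hatOp (fun u v w z => K u v w z) β ∈ lambda28 J := by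
  set b := stdOrthonormalBasis ℝ V
  refine ⟨fun u => ?_, fun u v => ?_, ?_⟩
  · rw [hatOp_apply K β b]
    exact Finset.sum_eq_zero fun k _ => Finset.sum_eq_zero fun l _ => by
      rw [hK.curvatureLike.self_left, zero_mul]
  · simp only [hatOp_apply K β b, hK.map_map_left]
  · set P := hatOp (fun u v w z => K u v w z) β
    have h1 : ∀ i, ∑ j, P (b i) (b j) * fundamentalForm J (b i) (b j) = P (b i) (J (b i)) :=
      fun i => by
        rw [← sum_inner_mul_apply b (P (b i)) (J (b i))]
        exact Finset.sum_congr rfl fun j _ => mul_comm _ _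
    change ∑ i, ∑ j, P (b i) (b j) * fundamentalForm J (b i) (b j) = 0
    simp_rw [h1, P, hatOp_apply K β b]
    rw [Finset.sum_comm]
    refine Finset.sum_eq_zero fun k _ => ?_
    rw [Finset.sum_comm]
    refine Finset.sum_eq_zero fun l _ => ?_
    rw [← Finset.sum_mul]
    simp_rw [fun i => hK.pair_symm (b i) (J (b i)) (b k) (b l)]
    rw [hK.trace_right, zero_mul]

end IsCalabiYauType

/-! ### Ricci tensor, Weyl tensor and `R̂` for the sphere tensor plus a Calabi–Yau type tensor. -/

/-- `R` is the sum of the curvature tensor of the unit sphere and `K`. -/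
def IsSpherePlus (R K : V →ₗ[ℝ] V →ₗ[ℝ] V →ₗ[ℝ] V →ₗ[ℝ] ℝ) : Prop :=
  ∀ u v w z, R u v w z = K u v w z + sphereTensor u v w z

variable {J : V →ₗ[ℝ] V} {R K : V →ₗ[ℝ] V →ₗ[ℝ] V →ₗ[ℝ] V →ₗ[ℝ] ℝ}

lemma IsSpherePlus.ricci_eq (hR : IsSpherePlus R K) (hK : IsCalabiYauType J K)
    (hJ : IsOrthogonalComplex J) (u v : V) :
    ricci (fun u v w z => R u v w z) u v = ((finrank ℝ V : ℝ) - 1) * inner ℝ u v := by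
  have h := hK.ricci_eq_zero hJ u v
  unfold ricci at h ⊢
  simp_rw [hR _ _ _ _, Finset.sum_add_distrib]
  rw [h, zero_add]
  unfold sphereTensor
  rw [Finset.sum_sub_distrib]
  have h2 := sum_inner_mul_apply (stdOrthonormalBasis ℝ V) (innerₗ V u) v
  simp only [innerₗ_apply_apply] at h2
  have h3 : ∀ k, inner ℝ (stdOrthonormalBasis ℝ V k) v * inner ℝ u (stdOrthonormalBasis ℝ V k) =
      inner ℝ v (stdOrthonormalBasis ℝ V k) * (inner ℝ u (stdOrthonormalBasis ℝ V k) : ℝ) :=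
    fun k => by rw [real_inner_comm]
  simp_rw [h3, h2]
  simp
  ring

/-- Since Ric = 5g, the traceless Ricci part vanishes and scal = 30. The scalar part has coefficient
30/(2·6·5) = 1/2, and g ∧ g is twice the sphere tensor, so exactly that tensor is removed. -/
lemma IsSpherePlus.weyl_eq (hR : IsSpherePlus R K) (hK : IsCalabiYauType J K)
    (hJ : IsOrthogonalComplex J) (hV : finrank ℝ V = 6) :
    weyl (fun u v w z => R u v w z) = fun u v w z => K u v w z := by
  have hs : scalar (fun u v w z => R u v w z) = 30 := by
    unfold scalar
    simp_rw [hR.ricci_eq hK hJ]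
    simp [hV]
    norm_num
  have ht : tracelessRicci (fun u v w z => R u v w z) = fun _ _ => 0 := by
    ext u v
    unfold tracelessRicci
    rw [hs, hR.ricci_eq hK hJ, hV]
    push_cast; ring
  ext u v w z
  unfold weyl
  simp only [hs, ht, hV]
  simp only [hR _ _ _ _]
  unfold kulkarniNomizu sphereTensor
  push_cast; ring

/-- In this sign convention the sphere tensor sends β_ij to β_ji - β_ij = -2 β_ij. -/
lemma IsSpherePlus.hatOp_eq (hR : IsSpherePlus R K) {β : LinearMap.BilinForm ℝ V}
    (hβ : β.IsAlt) :
    hatOp (fun u v w z => R u v w z) β = hatOp (fun u v w z => K u v w z) β - (2 : ℝ) • β := by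
  set b := stdOrthonormalBasis ℝ V
  refine LinearMap.ext fun u => LinearMap.ext fun v => ?_
  simp only [LinearMap.sub_apply, LinearMap.smul_apply, smul_eq_mul, hatOp_apply _ β b]
  have h1 : ∀ f : V →ₗ[ℝ] ℝ, ∀ x, ∑ l, inner ℝ x (b l) * f (b l) = f x :=
    fun f x => sum_inner_mul_apply b f x
  have h2 : ∀ k, ∑ l, R u v (b k) (b l) * β (b k) (b l) =
      ∑ l, K u v (b k) (b l) * β (b k) (b l) +
        (inner ℝ v (b k) * LinearMap.flip β u (b k) - inner ℝ u (b k) * LinearMap.flip β v (b k)) := fun k => by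
    rw [LinearMap.flip_apply, LinearMap.flip_apply, ← h1 (β (b k)) u, ← h1 (β (b k)) v,
      Finset.mul_sum, Finset.mul_sum, ← Finset.sum_sub_distrib, ← Finset.sum_add_distrib]
    refine Finset.sum_congr rfl fun l _ => ?_
    rw [hR]; unfold sphereTensor; ring
  simp_rw [h2, Finset.sum_add_distrib, Finset.sum_sub_distrib, h1, LinearMap.flip_apply]
  rw [← LinearMap.IsAlt.neg hβ u v]; ring

end CalabiYauCurvature

/-! ### J-adapted diagonalisation and consequences of pinching. -/

section EigenvalueBounds

variable {V : Type*} [NormedAddCommGroup V] [InnerProductSpace ℝ V]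

/-! ### Simultaneous diagonalisation -/

/-- The self-adjoint operator of `h` preserves the orthogonal complement of a set of eigenvectors,
and the cardinality bound makes that complement nonzero. -/
lemma exists_unit_eigenvector_orthogonal [FiniteDimensional ℝ V] {h : LinearMap.BilinForm ℝ V}
    (hsymm : ∀ u v, h u v = h v u) (s : Finset V) (hs : s.card < finrank ℝ V)
    (hev : ∀ x ∈ s, ∃ c : ℝ, ∀ w, h x w = c * inner ℝ x w) :
    ∃ (v : V) (c : ℝ), ‖v‖ = 1 ∧ (∀ x ∈ s, inner ℝ x v = (0 : ℝ)) ∧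
      ∀ w, h v w = c * inner ℝ v w := by
  classical
  let A : V →ₗ[ℝ] V := (InnerProductSpace.toDual ℝ V).symm.toLinearEquiv.toLinearMap ∘ₗ
    LinearMap.toContinuousLinearMap.toLinearMap ∘ₗ h
  have hA : ∀ u v, (inner ℝ (A u) v : ℝ) = h u v := fun u v => by
    simp [A]
  have hAs : A.IsSymmetric := fun u v => by
    rw [hA, real_inner_comm, hA, hsymm]
  let W : Submodule ℝ V := (Submodule.span ℝ (s : Set V))ᗮ
  have hWmem : ∀ w, w ∈ W ↔ ∀ x ∈ s, inner ℝ x w = (0 : ℝ) := fun w => by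
    refine ⟨fun hw x hx => hw x (Submodule.subset_span hx), fun hw => ?_⟩
    rw [Submodule.mem_orthogonal]
    intro y hy
    induction hy using Submodule.span_induction with
    | mem x hx => exact hw x hx
    | zero => simp
    | add y z _ _ hy hz => rw [inner_add_left, hy, hz, add_zero]
    | smul c y _ hy => rw [inner_smul_left, hy, mul_zero]
  have hWA : ∀ w ∈ W, A w ∈ W := fun w hw => by
    rw [hWmem] at hw ⊢
    intro x hx
    obtain ⟨c, hc⟩ := hev x hx
    rw [← hAs, hA, hc, hw x hx, mul_zero]
  have hdim : finrank ℝ (Submodule.span ℝ (s : Set V)) + finrank ℝ W = finrank ℝ V :=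
    Submodule.finrank_add_finrank_orthogonal _
  have hle : finrank ℝ (Submodule.span ℝ (s : Set V)) ≤ s.card := finrank_span_finset_le_card s
  have : Nontrivial W := Module.finrank_pos_iff (R := ℝ).mp (by omega)
  obtain ⟨⟨v, hvW⟩, hv⟩ :=
    (hAs.restrict_invariant hWA).hasEigenvalue_iSup_of_finiteDimensional.exists_hasEigenvector
  obtain ⟨hv1, hv0⟩ := hv
  rw [Module.End.mem_eigenspace_iff] at hv1
  -- The eigenvalue is a supremum of Rayleigh quotients; only its existence matters.
  generalize (⨆ x : { x : W // x ≠ 0 }, _ : ℝ) = c at hv1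
  have hv2 : A v = c • v := congrArg Subtype.val hv1
  have hv3 : v ≠ 0 := fun h0 => hv0 (Subtype.ext h0)
  refine ⟨‖v‖⁻¹ • v, c, norm_smul_inv_norm (𝕜 := ℝ) hv3, fun x hx => ?_, fun w => ?_⟩
  · rw [inner_smul_right, (hWmem v).mp hvW x hx, mul_zero]
  · rw [← hA, map_smul, hv2, smul_comm, inner_smul_left]; rfl

/-- An orthonormal basis `v₁, Jv₁, v₂, Jv₂, v₃, Jv₃` from a triple of vectors. -/
lemma exists_adapted_basis [FiniteDimensional ℝ V] {J : V →ₗ[ℝ] V} (hJ : IsOrthogonalComplex J)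
    (hV : finrank ℝ V = 6) (v : Fin 3 → V)
    (hv : ∀ a b, inner ℝ (v a) (v b) = if a = b then (1 : ℝ) else 0)
    (hv' : ∀ a b, a ≠ b → inner ℝ (J (v a)) (v b) = (0 : ℝ)) :
    ∃ f : OrthonormalBasis (Fin 3 × Fin 2) ℝ V,
      (∀ a, f (a, 0) = v a) ∧ ∀ a, f (a, 1) = J (v a) := by
  have h0 : ∀ a b, inner ℝ (J (v a)) (v b) = (0 : ℝ) := fun a b => by
    by_cases hab : a = b
    · rw [hab, hJ.inner_map_self]
    · exact hv' a b hab
  let g : Fin 3 × Fin 2 → V := fun p => if p.2 = 0 then v p.1 else J (v p.1)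
  have hg : Orthonormal ℝ g := by
    rw [orthonormal_iff_ite]
    rintro ⟨a, i⟩ ⟨b, j⟩
    fin_cases i <;> fin_cases j
    · simp [g, hv]
    · simpa [g] using (real_inner_comm _ _).trans (h0 b a)
    · simp [g, h0]
    · simp [g, hv, hJ.inner_map_map]
  have hspan : ⊤ ≤ Submodule.span ℝ (Set.range g) := by
    rw [hg.linearIndependent.span_eq_top_of_card_eq_finrank (by simp [hV])]
  exact ⟨OrthonormalBasis.mk hg hspan, fun a => by simp [g], fun a => by simp [g]⟩

/-- An eigenvector v brings Jv with the same eigenvalue. Eigenvectors are chosen three times,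
orthogonally to the 0, 2, then 4 vectors already present. -/
lemma exists_adapted_eigenbasis [FiniteDimensional ℝ V] {J : V →ₗ[ℝ] V}
    (hJ : IsOrthogonalComplex J) (hV : finrank ℝ V = 6) {h : LinearMap.BilinForm ℝ V}
    (hsymm : ∀ u v, h u v = h v u) (hcomm : ∀ u v, h (J u) (J v) = h u v) :
    ∃ (f : OrthonormalBasis (Fin 3 × Fin 2) ℝ V) (c : Fin 3 → ℝ),
      (∀ a, f (a, 1) = J (f (a, 0))) ∧ ∀ a w, h (f (a, 0)) w = c a * inner ℝ (f (a, 0)) w := by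
  classical
  have hmap : ∀ (u : V) (c : ℝ), (∀ w, h u w = c * inner ℝ u w) →
      ∀ w, h (J u) w = c * inner ℝ (J u) w := fun u c hu w => by
    have h1 := hcomm u (-J w)
    have h2 := hJ.inner_map_left u w
    rw [map_neg, hJ.sq, neg_neg, hu, inner_neg_right] at h1
    rw [h1, h2]
  obtain ⟨v0, c0, n0, -, e0⟩ := exists_unit_eigenvector_orthogonal hsymm ∅ (by simp [hV])
    (by simp)
  obtain ⟨v1, c1, n1, o1, e1⟩ := exists_unit_eigenvector_orthogonal hsymm {v0, J v0}
    (by rw [hV]; exact Finset.card_le_two.trans_lt (by norm_num)) (by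
      simp only [Finset.mem_insert, Finset.mem_singleton, forall_eq_or_imp, forall_eq]
      exact ⟨⟨c0, e0⟩, ⟨c0, hmap _ _ e0⟩⟩)
  obtain ⟨v2, c2, n2, o2, e2⟩ := exists_unit_eigenvector_orthogonal hsymm {v0, J v0, v1, J v1}
    (by rw [hV]; exact Finset.card_le_four.trans_lt (by norm_num)) (by
      simp only [Finset.mem_insert, Finset.mem_singleton, forall_eq_or_imp, forall_eq]
      exact ⟨⟨c0, e0⟩, ⟨c0, hmap _ _ e0⟩, ⟨c1, e1⟩, ⟨c1, hmap _ _ e1⟩⟩)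
  simp only [Finset.mem_insert, Finset.mem_singleton, forall_eq_or_imp, forall_eq] at o1 o2
  obtain ⟨o10, o10'⟩ := o1
  obtain ⟨o20, o20', o21, o21'⟩ := o2
  have hJs : ∀ u v, inner ℝ (J u) v = (0 : ℝ) → inner ℝ (J v) u = (0 : ℝ) := fun u v huv => by
    rw [hJ.inner_map_left, real_inner_comm, huv, neg_zero]
  have o01 := real_inner_comm v0 v1 ▸ o10
  obtain ⟨f, hf0, hf1⟩ := exists_adapted_basis hJ hV ![v0, v1, v2]
    (by
      intro a b
      fin_cases a <;> fin_cases b <;>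
        simp [n0, n1, n2, o10, o20, o21, real_inner_comm v0, real_inner_comm v1 v2])
    (by
      intro a b hab
      fin_cases a <;> fin_cases b <;>
        simp_all)
  refine ⟨f, ![c0, c1, c2], fun a => by rw [hf0, hf1], fun a w => ?_⟩
  rw [hf0]
  fin_cases a
  · exact e0 w
  · exact e1 w
  · exact e2 w

/-! ### Berger's estimate -/

/-- Pinching of the sectional curvature on orthogonal pairs. -/
def IsPinched (R : V →ₗ[ℝ] V →ₗ[ℝ] V →ₗ[ℝ] V →ₗ[ℝ] ℝ) (δ Δ : ℝ) : Prop :=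
  ∀ u v, inner ℝ u v = (0 : ℝ) →
    δ * (‖u‖ ^ 2 * ‖v‖ ^ 2) ≤ R u v v u ∧ R u v v u ≤ Δ * (‖u‖ ^ 2 * ‖v‖ ^ 2)

/-- With the denominator cleared, zero vectors are allowed, so polarisation needs no case
distinction. -/
lemma isPinched_of_sectional {R : V →ₗ[ℝ] V →ₗ[ℝ] V →ₗ[ℝ] V →ₗ[ℝ] ℝ} {δ Δ : ℝ}
    (h : ∀ u v, LinearIndependent ℝ ![u, v] →
      sectional (fun u v w z => R u v w z) u v ∈ Set.Icc δ Δ) : IsPinched R δ Δ := by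
  intro u v huv
  by_cases hu : u = 0
  · simp [hu]
  by_cases hv : v = 0
  · simp [hv]
  have hli : LinearIndependent ℝ ![u, v] := by
    refine linearIndependent_of_ne_zero_of_inner_eq_zero (𝕜 := ℝ) ?_ ?_
    · intro i; fin_cases i <;> simp [hu, hv]
    · intro i j hij
      fin_cases i <;> fin_cases j <;> simp_all [real_inner_comm]
  obtain ⟨h1, h2⟩ := h u v hli
  unfold sectional at h1 h2
  have hpos : 0 < ‖u‖ ^ 2 * ‖v‖ ^ 2 := by positivity
  rw [huv, zero_pow two_ne_zero, sub_zero] at h1 h2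
  rw [le_div_iff₀ hpos] at h1
  rw [div_le_iff₀ hpos] at h2
  exact ⟨h1, h2⟩

lemma norm_add_sq_of_inner_eq_zero {u v : V} (h : inner ℝ u v = (0 : ℝ)) :
    ‖u + v‖ ^ 2 = ‖u‖ ^ 2 + ‖v‖ ^ 2 := by
  rw [norm_add_sq_real, h]; ring

lemma norm_sub_sq_of_inner_eq_zero {u v : V} (h : inner ℝ u v = (0 : ℝ)) :
    ‖u - v‖ ^ 2 = ‖u‖ ^ 2 + ‖v‖ ^ 2 := by
  rw [norm_sub_sq_real, h]; ring

variable {R : V →ₗ[ℝ] V →ₗ[ℝ] V →ₗ[ℝ] V →ₗ[ℝ] ℝ} {δ Δ : ℝ}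

lemma sub_left_apply (R : V →ₗ[ℝ] V →ₗ[ℝ] V →ₗ[ℝ] V →ₗ[ℝ] ℝ) (u u' v w z : V) :
    R (u - u') v w z = R u v w z - R u' v w z := by
  rw [sub_eq_add_neg, ← neg_one_smul ℝ u', map_add, map_smul]
  simp only [LinearMap.add_apply, LinearMap.smul_apply, smul_eq_mul]
  ring

/-- Polarisation in the outer pair: 4 R(x,y,y,w) is the difference of the values at x + w and x - w,
both of squared norm 2. -/
lemma IsPinched.abs_jacobi_le (hR : IsCurvatureLike (fun u v w z => R u v w z))
    (h : IsPinched R δ Δ) {x y w : V} (hx : ‖x‖ = 1) (hw : ‖w‖ = 1)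
    (hxy : inner ℝ x y = (0 : ℝ)) (hwy : inner ℝ w y = (0 : ℝ)) (hxw : inner ℝ x w = (0 : ℝ)) :
    |R x y y w| ≤ (Δ - δ) / 2 * ‖y‖ ^ 2 := by
  obtain ⟨h1, h2⟩ := h (x + w) y (by rw [inner_add_left, hxy, hwy, add_zero])
  obtain ⟨h3, h4⟩ := h (x - w) y (by rw [inner_sub_left, hxy, hwy, sub_zero])
  rw [norm_add_sq_of_inner_eq_zero hxw, hx, hw] at h1 h2
  rw [norm_sub_sq_of_inner_eq_zero hxw, hx, hw] at h3 h4
  have e : R w y y x = R x y y w := by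
    have a1 := hR.pair_symm w y y x
    have a2 := hR.skew_left y x w y
    have a3 := hR.skew_right x y w y
    linarith
  have e1 : R (x + w) y y (x + w) - R (x - w) y y (x - w) = 4 * R x y y w := by
    rw [sub_left_apply]
    simp only [map_add, map_sub, LinearMap.add_apply, e]; ring
  rw [abs_le]
  constructor <;> linarith

/-- Berger's estimate. -/
lemma IsPinched.abs_le (hR : IsCurvatureLike (fun u v w z => R u v w z))
    (h : IsPinched R δ Δ) {x y z w : V} (hx : ‖x‖ = 1) (hy : ‖y‖ = 1) (hz : ‖z‖ = 1)
    (hw : ‖w‖ = 1) (hxy : inner ℝ x y = (0 : ℝ)) (hxz : inner ℝ x z = (0 : ℝ))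
    (hxw : inner ℝ x w = (0 : ℝ)) (hyz : inner ℝ y z = (0 : ℝ)) (hyw : inner ℝ y w = (0 : ℝ))
    (hzw : inner ℝ z w = (0 : ℝ)) :
    |R x y z w| ≤ 2 / 3 * (Δ - δ) := by
  -- Polarisation in the middle pair: the values at y + z and y - z differ by twice the symmetrised
  -- component, and each is at most Δ - δ in absolute value.
  have polar : ∀ {x y z : V}, ‖x‖ = 1 → ‖y‖ = 1 → ‖z‖ = 1 → inner ℝ x y = (0 : ℝ) →
      inner ℝ x z = (0 : ℝ) → inner ℝ x w = (0 : ℝ) → inner ℝ y z = (0 : ℝ) →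
      inner ℝ y w = (0 : ℝ) → inner ℝ z w = (0 : ℝ) → |R x y z w + R x z y w| ≤ Δ - δ := by
    intro x y z hx hy hz hxy hxz hxw hyz hyw hzw
    have h1 := h.abs_jacobi_le hR (y := y + z) hx hw (by rw [inner_add_right, hxy, hxz, add_zero])
      (by rw [inner_add_right, real_inner_comm, hyw, real_inner_comm, hzw, add_zero]) hxw
    have h2 := h.abs_jacobi_le hR (y := y - z) hx hw (by rw [inner_sub_right, hxy, hxz, sub_zero])
      (by rw [inner_sub_right, real_inner_comm, hyw, real_inner_comm, hzw, sub_zero]) hxw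
    rw [norm_add_sq_of_inner_eq_zero hyz, hy, hz] at h1
    rw [norm_sub_sq_of_inner_eq_zero hyz, hy, hz] at h2
    rw [_root_.abs_le] at h1 h2 ⊢
    simp only [map_add, map_sub, LinearMap.add_apply, LinearMap.sub_apply] at h1 h2
    constructor <;> linarith [h1.1, h1.2, h2.1, h2.2]
  have p1 := polar hx hy hz hxy hxz hxw hyz hyw hzw
  have p2 := polar hy hx hz (by rw [real_inner_comm, hxy]) hyz hyw hxz hxw hzw
  -- By Bianchi the two polarised quantities differ by 3 R(x,y,z,w), whence the constant 2/3.
  have b1 := hR.bianchi x y z w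
  have b2 := hR.skew_left z x y w
  have b3 := hR.skew_left x y z w
  rw [_root_.abs_le] at p1 p2 ⊢
  constructor <;> linarith [p1.1, p1.2, p2.1, p2.2]

lemma IsPinched.mem_Icc (h : IsPinched R δ Δ) {x y : V} (hx : ‖x‖ = 1) (hy : ‖y‖ = 1)
    (hxy : inner ℝ x y = (0 : ℝ)) : R x y y x ∈ Set.Icc δ Δ := by
  have := h x y hxy
  rw [hx, hy] at this
  constructor <;> linarith [this.1, this.2]

end EigenvalueBounds

section EigenvalueBounds

variable {V : Type*} [NormedAddCommGroup V] [InnerProductSpace ℝ V] [FiniteDimensional ℝ V]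
variable {J : V →ₗ[ℝ] V} {R K : V →ₗ[ℝ] V →ₗ[ℝ] V →ₗ[ℝ] V →ₗ[ℝ] ℝ} {δ Δ : ℝ}

/-! ### Eigenvalues on `Λ²₈` -/

lemma IsSpherePlus.isCurvatureLike (hR : IsSpherePlus R K) (hK : IsCalabiYauType J K) :
    IsCurvatureLike (fun u v w z => R u v w z) where
  skew_left u v w z := by
    simp only [hR _ _ _ _]
    rw [hK.skew_left, isCurvatureLike_sphereTensor.skew_left]; ring
  skew_right u v w z := by
    simp only [hR _ _ _ _]
    rw [hK.skew_right, isCurvatureLike_sphereTensor.skew_right]; ring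
  bianchi u v w z := by
    simp only [hR _ _ _ _]
    linarith [hK.bianchi u v w z, isCurvatureLike_sphereTensor.bianchi u v w z]

/-- The mixed component on a pair of `J`-invariant planes, in terms of sectional curvatures. -/
lemma IsSpherePlus.apply_map_map (hR : IsSpherePlus R K) (hK : IsCalabiYauType J K)
    (hJ : IsOrthogonalComplex J) {u v : V} (hu : ‖u‖ = 1) (hv : ‖v‖ = 1)
    (huv : inner ℝ u v = (0 : ℝ)) (hJuv : inner ℝ (J u) v = (0 : ℝ)) :
    R u (J u) v (J v) = 2 - R u v v u - R (J u) v v (J u) := by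
  have hJu : (inner ℝ (J u) (J u) : ℝ) = 1 := by
    rw [hJ.inner_map_map, real_inner_self_eq_norm_sq, hu, one_pow]
  have huu : (inner ℝ u u : ℝ) = 1 := by rw [real_inner_self_eq_norm_sq, hu, one_pow]
  have hvv : (inner ℝ v v : ℝ) = 1 := by rw [real_inner_self_eq_norm_sq, hv, one_pow]
  have huJv : (inner ℝ u (J v) : ℝ) = 0 := by
    have := hJ.inner_map_left u v
    linarith
  simp only [hR _ _ _ _, sphereTensor, hJu, huu, hvv, huv, hJuv, huJv, hJ.inner_map_map,
    real_inner_comm u v, real_inner_comm (J u) v]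
  -- For `K` the mixed component is minus the sum of the two sectional terms. The sphere adds 1 to
  -- each of those and nothing to the mixed component, which accounts for the 2.
  have h1 := hK.apply_map_right hJ u (J u) v v
  have h2 := hK.skew_left v (J u) v (J u)
  have h3 := hK.skew_left v u v u
  rw [hJ.sq, map_neg] at h1
  linarith

/-- Elements of `Λ²₈` in an adapted orthonormal basis. -/
lemma exists_normal_form (hJ : IsOrthogonalComplex J) (hV : finrank ℝ V = 6)
    {β : LinearMap.BilinForm ℝ V} (hβ : β ∈ lambda28 J) :
    ∃ (f : OrthonormalBasis (Fin 3 × Fin 2) ℝ V) (c : Fin 3 → ℝ),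
      (∀ a, f (a, 1) = J (f (a, 0))) ∧ (∀ a w, β (f (a, 0)) w = c a * inner ℝ (f (a, 1)) w) ∧
      (∀ a w, β (f (a, 1)) w = -(c a * inner ℝ (f (a, 0)) w)) ∧ ∑ a, c a = 0 := by
  obtain ⟨halt, hcomm, htr⟩ := hβ
  have hleft : ∀ u v, β (J u) v = -β u (J v) := fun u v => by
    have := hcomm u (J v)
    rw [hJ.sq, map_neg] at this
    linarith
  -- The form β(·, J·) is symmetric and J-invariant, so it can be diagonalised; its trace is the
  -- contraction of `β` with `ω`, and each J-plane contributes 2 c_a to it.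
  obtain ⟨f, c, hf, hc⟩ := exists_adapted_eigenbasis hJ hV
    (h := β.compl₂ J) (fun u v => by
      simp only [LinearMap.compl₂_apply]
      rw [← LinearMap.IsAlt.neg halt, hleft, neg_neg])
    (fun u v => by
      simp only [LinearMap.compl₂_apply]; rw [hcomm])
  simp only [LinearMap.compl₂_apply] at hc
  have h0 : ∀ a w, β (f (a, 0)) w = c a * inner ℝ (f (a, 1)) w := fun a w => by
    have := hc a (J w)
    rw [hJ.sq, map_neg] at this
    rw [hf, hJ.inner_map_left]
    linarith
  refine ⟨f, c, hf, h0, fun a w => ?_, ?_⟩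
  · rw [hf, hleft, hc]
  · set b := stdOrthonormalBasis ℝ V
    have h1 : ∀ i, ∑ j, β (b i) (b j) * fundamentalForm J (b i) (b j) = β (b i) (J (b i)) :=
      fun i => by
        rw [← sum_inner_mul_apply b (β (b i)) (J (b i))]
        exact Finset.sum_congr rfl fun j _ => mul_comm _ _
    change ∑ i, ∑ j, β (b i) (b j) * fundamentalForm J (b i) (b j) = 0 at htr
    simp_rw [h1] at htr
    have h2 := sum_apply_apply_eq b f (β.compl₂ J)
    simp only [LinearMap.compl₂_apply] at h2
    rw [htr, Fintype.sum_prod_type] at h2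
    have h3 : ∀ a, ∑ i : Fin 2, β (f (a, i)) (J (f (a, i))) = 2 * c a := fun a => by
      rw [Fin.sum_univ_two, hf, hcomm, hc, real_inner_self_eq_norm_sq, f.norm_eq_one]; ring
    simp_rw [h3, ← Finset.mul_sum] at h2
    linarith

/-- Only the three J-planes contribute to the contraction, each once per ordering of its basis,
hence the factor 2. -/
lemma hatOp_apply_of_normal_form {β : LinearMap.BilinForm ℝ V}
    {f : OrthonormalBasis (Fin 3 × Fin 2) ℝ V} {c : Fin 3 → ℝ}
    (h0 : ∀ a w, β (f (a, 0)) w = c a * inner ℝ (f (a, 1)) w)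
    (h1 : ∀ a w, β (f (a, 1)) w = -(c a * inner ℝ (f (a, 0)) w))
    (hR : IsCurvatureLike (fun u v w z => R u v w z)) (u v : V) :
    hatOp (fun u v w z => R u v w z) β u v = 2 * ∑ a, c a * R u v (f (a, 0)) (f (a, 1)) := by
  rw [hatOp_apply R β f, Fintype.sum_prod_type, Finset.mul_sum]
  refine Finset.sum_congr rfl fun a _ => ?_
  have e0 : ∑ l, R u v (f (a, 0)) (f l) * β (f (a, 0)) (f l) =
      c a * R u v (f (a, 0)) (f (a, 1)) := by
    rw [← sum_inner_mul_apply f (R u v (f (a, 0))) (f (a, 1)), Finset.mul_sum]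
    exact Finset.sum_congr rfl fun l _ => by rw [h0]; ring
  have e1 : ∑ l, R u v (f (a, 1)) (f l) * β (f (a, 1)) (f l) =
      c a * R u v (f (a, 0)) (f (a, 1)) := by
    have := hR.skew_right u v (f (a, 1)) (f (a, 0))
    rw [← neg_eq_iff_eq_neg] at this
    rw [← this, ← sum_inner_mul_apply f (R u v (f (a, 1))) (f (a, 0)), mul_neg, Finset.mul_sum,
      ← Finset.sum_neg_distrib]
    exact Finset.sum_congr rfl fun l _ => by rw [h1]; ring
  rw [Fin.sum_univ_two, e0, e1]; ring

lemma exists_others (a : Fin 3) : ∃ b c, a ≠ b ∧ a ≠ c ∧ ∀ g : Fin 3 → ℝ,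
    ∑ i, g i = g a + g b + g c := by
  fin_cases a
  · exact ⟨1, 2, by decide, by decide, fun g => by rw [Fin.sum_univ_three]; rfl⟩
  · exact ⟨0, 2, by decide, by decide, fun g => by
      rw [Fin.sum_univ_three]; simp only [Fin.mk_one]; ring⟩
  · exact ⟨0, 1, by decide, by decide, fun g => by
      rw [Fin.sum_univ_three]; simp only [Fin.reduceFinMk]; ring⟩

/-- The weights `-b`, `-c` are convex when `1` has the largest absolute value among
`1, b, c` and `1 + b + c = 0`. -/
lemma exists_convex_weights {x y z : ℝ} (hx : x ≠ 0) (hsum : x + y + z = 0) (hy : |y| ≤ |x|)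
    (hz : |z| ≤ |x|) : ∃ s t : ℝ, 0 ≤ s ∧ 0 ≤ t ∧ s + t = 1 ∧ y = -(s * x) ∧ z = -(t * x) := by
  have hb : |y / x| ≤ 1 := by rw [abs_div]; exact div_le_one_of_le₀ hy (abs_nonneg x)
  have hc : |z / x| ≤ 1 := by rw [abs_div]; exact div_le_one_of_le₀ hz (abs_nonneg x)
  have h : -(y / x) + -(z / x) = 1 := by field_simp; linarith
  rw [abs_le] at hb hc
  exact ⟨-(y / x), -(z / x), by linarith [hc.1], by linarith [hb.1], h,
    by field_simp, by field_simp⟩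

/-- The eigenvalues of `R̂` on `Λ²₈` under pinching. -/
theorem eigenvalue_mem_Icc (hR : IsSpherePlus R K) (hK : IsCalabiYauType J K)
    (hJ : IsOrthogonalComplex J) (hV : finrank ℝ V = 6) (hp : IsPinched R δ Δ)
    {β : LinearMap.BilinForm ℝ V} (hβ : β ∈ lambda28 J) {μ : ℝ}
    (hμ : Module.End.HasEigenvector (hatOp (fun u v w z => R u v w z)) μ β) :
    μ ∈ Set.Icc (-4 + (Δ + δ) - 3 * (Δ - δ)) (-4 + (Δ + δ) + 3 * (Δ - δ)) ∩
        Set.Icc (-(Δ + δ) - 7 / 3 * (Δ - δ)) (-(Δ + δ) + 7 / 3 * (Δ - δ)) := by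
  have hRc := hR.isCurvatureLike hK
  obtain ⟨f, c, hf, h0, h1, hsum⟩ := exists_normal_form hJ hV hβ
  obtain ⟨hμ1, hβ0⟩ := hμ
  rw [Module.End.mem_eigenspace_iff] at hμ1
  have hort : ∀ p q, p ≠ q → inner ℝ (f p) (f q) = (0 : ℝ) := fun p q hpq =>
    f.orthonormal.2 hpq
  have heig : ∀ a, μ * c a =
      2 * ∑ b, c b * R (f (a, 0)) (f (a, 1)) (f (b, 0)) (f (b, 1)) := fun a => by
    rw [← hatOp_apply_of_normal_form h0 h1 hRc, hμ1, LinearMap.smul_apply, LinearMap.smul_apply,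
      h0, real_inner_self_eq_norm_sq, f.norm_eq_one, smul_eq_mul]
    ring
  -- Maximality of |c a|, together with ∑ c = 0, makes the other two coefficients -s c_a and -t c_a
  -- with s, t ≥ 0 and s + t = 1.
  obtain ⟨a, ha⟩ := Finite.exists_max fun a => |c a|
  have hca : c a ≠ 0 := by
    intro hca
    have hc : ∀ b, c b = 0 := fun b => by
      have := ha b
      rw [hca, abs_zero] at this
      exact abs_eq_zero.mp (le_antisymm this (abs_nonneg _))
    refine hβ0 (f.toBasis.ext ?_)
    rintro ⟨b, i⟩
    ext w
    fin_cases i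
    · simp [h0, hc]
    · simp [h1, hc]
  obtain ⟨b, d, hab, had, hsum3⟩ := exists_others a
  rw [hsum3] at hsum
  obtain ⟨s, t, hs, ht, hst, hb, hd⟩ := exists_convex_weights hca hsum (ha b) (ha d)
  have hmain : μ = 2 * (R (f (a, 0)) (f (a, 1)) (f (a, 0)) (f (a, 1)) -
      s * R (f (a, 0)) (f (a, 1)) (f (b, 0)) (f (b, 1)) -
      t * R (f (a, 0)) (f (a, 1)) (f (d, 0)) (f (d, 1))) := by
    apply mul_right_cancel₀ hca
    rw [heig a, hsum3, hb, hd]; ring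
  have hsec : R (f (a, 0)) (f (a, 1)) (f (a, 0)) (f (a, 1)) =
      -R (f (a, 0)) (f (a, 1)) (f (a, 1)) (f (a, 0)) := hRc.skew_right _ _ _ _
  rw [hsec] at hmain
  have n := f.norm_eq_one
  obtain ⟨l0, u0⟩ := hp.mem_Icc (n (a, 0)) (n (a, 1)) (hort _ _ (by simp))
  have hs1 : s = 1 - t := by linarith
  constructor
  -- First interval: -sec lies in [-Δ, -δ] and a convex mean of mixed terms in [2 - 2Δ, 2 - 2δ], so
  -- μ lies in [-4 - 2Δ + 4δ, -4 - 2δ + 4Δ].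
  · have key : ∀ e, a ≠ e → R (f (a, 0)) (f (a, 1)) (f (e, 0)) (f (e, 1)) ∈
        Set.Icc (2 - 2 * Δ) (2 - 2 * δ) := fun e hae => by
      rw [hf, hf, hR.apply_map_map hK hJ (n _) (n _) (hort _ _ (by simp [hae]))
        (by rw [← hf]; exact hort _ _ (by simp)), ← hf]
      obtain ⟨l1, u1⟩ := hp.mem_Icc (n (a, 0)) (n (e, 0)) (hort _ _ (by simp [hae]))
      obtain ⟨l2, u2⟩ := hp.mem_Icc (n (a, 1)) (n (e, 0)) (hort _ _ (by simp))
      constructor <;> linarith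
    obtain ⟨lb, ub⟩ := key b hab
    obtain ⟨ld, ud⟩ := key d had
    rw [hmain, hs1]
    have ht1 : 0 ≤ 1 - t := hs1 ▸ hs
    constructor
    · nlinarith [mul_le_mul_of_nonneg_left ub ht1, mul_le_mul_of_nonneg_left ud ht]
    · nlinarith [mul_le_mul_of_nonneg_left lb ht1, mul_le_mul_of_nonneg_left ld ht]
  -- Second interval: -2 sec has radius Δ - δ about -(Δ + δ), and Berger's bound adds 4/3 (Δ - δ),
  -- giving 7/3.
  · have key : ∀ e, a ≠ e → |R (f (a, 0)) (f (a, 1)) (f (e, 0)) (f (e, 1))| ≤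
        2 / 3 * (Δ - δ) := fun e hae =>
      hp.abs_le hRc (n _) (n _) (n _) (n _) (hort _ _ (by simp)) (hort _ _ (by simp [hae]))
        (hort _ _ (by simp)) (hort _ _ (by simp)) (hort _ _ (by simp [hae]))
        (hort _ _ (by simp))
    obtain ⟨lb, ub⟩ := abs_le.mp (key b hab)
    obtain ⟨ld, ud⟩ := abs_le.mp (key d had)
    rw [hmain, hs1]
    have ht1 : 0 ≤ 1 - t := hs1 ▸ hs
    constructor
    · nlinarith [mul_le_mul_of_nonneg_left ub ht1, mul_le_mul_of_nonneg_left ud ht]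
    · nlinarith [mul_le_mul_of_nonneg_left lb ht1, mul_le_mul_of_nonneg_left ld ht]

end EigenvalueBounds

section SmoothFields

open VectorField Topology

variable {E : Type*} [NormedAddCommGroup E] [NormedSpace ℝ E] [FiniteDimensional ℝ E]
  {M : Type*} [TopologicalSpace M] [ChartedSpace E M] [IsManifold 𝓘(ℝ, E) ∞ M]

/-! ### Smooth vector fields -/

/-- The extensions used in `curvature` are smooth only near the point; a bump function makes them
global without changing their germ. -/
lemma exists_contMDiff_eventuallyEq_extend [T2Space M] {x : M} (u : TangentSpace 𝓘(ℝ, E) x) :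
    ∃ X : Π y : M, TangentSpace 𝓘(ℝ, E) y, CMDiff ∞ (T% X) ∧ X x = u ∧
      ∀ᶠ y in 𝓝 x, X y = FiberBundle.extend E u y := by
  obtain ⟨s, hs, hsm⟩ := FiberBundle.exists_contMDiffOn_extend (k := ∞) 𝓘(ℝ, E) E u
  obtain ⟨t, hts, hto, hxt⟩ := mem_nhds_iff.mp hs
  obtain ⟨f, -, hf⟩ := (SmoothBumpFunction.nhds_basis_tsupport (I := 𝓘(ℝ, E)) x).mem_iff.mp
    (hto.mem_nhds hxt)
  have h : ∀ᶠ y in 𝓝 x, ((f : M → ℝ) • FiberBundle.extend E u) y = FiberBundle.extend E u y := by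
    filter_upwards [f.eventuallyEq_one] with y hy
    change f y • FiberBundle.extend E u y = _
    rw [hy, Pi.one_apply, one_smul]
  exact ⟨(f : M → ℝ) • FiberBundle.extend E u,
    ContMDiffOn.smul_section_of_tsupport f.contMDiff.contMDiffOn hto hf (hsm.mono hts),
    by rw [h.self_of_nhds, FiberBundle.extend_apply_self], h⟩

variable {cov : CovariantDerivative 𝓘(ℝ, E) E (fun x : M => TangentSpace 𝓘(ℝ, E) x)}

omit [FiniteDimensional ℝ E] in
lemma contMDiff_cov_apply (hcov : CovariantDerivative.ContMDiffCovariantDerivative cov ∞)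
    {X Y : Π y : M, TangentSpace 𝓘(ℝ, E) y} (hX : CMDiff ∞ (T% X)) (hY : CMDiff ∞ (T% Y)) :
    CMDiff ∞ (T% (fun y => cov Y y (X y))) := by
  have h := hcov.contMDiff.contMDiff (σ := Y) (by simpa using hY.contMDiffOn)
  rw [contMDiffOn_univ] at h
  exact h.clm_bundle_apply hX

lemma contMDiff_mlieBracket {X Y : Π y : M, TangentSpace 𝓘(ℝ, E) y}
    (hX : CMDiff ∞ (T% X)) (hY : CMDiff ∞ (T% Y)) :
    CMDiff ∞ (T% (mlieBracket 𝓘(ℝ, E) X Y)) := by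
  have : IsManifold 𝓘(ℝ, E) ((⊤ : ℕ∞) + 1) M := by simpa using ‹IsManifold 𝓘(ℝ, E) ∞ M›
  have h2 : IsManifold 𝓘(ℝ, E) (minSmoothness ℝ 2) M := by
    simp only [minSmoothness_of_isRCLikeNormedField]
    infer_instance
  exact fun x => ContMDiffAt.mlieBracket_vectorField (m := ⊤) (n := ⊤) (hX x) (hY x) (by simp)

omit [FiniteDimensional ℝ E] in
lemma mdiffAt_of_contMDiff {X : Π y : M, TangentSpace 𝓘(ℝ, E) y} (hX : CMDiff ∞ (T% X)) (x : M) :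
    MDiffAt (T% X) x := (hX x).mdifferentiableAt (by simp)

omit [FiniteDimensional ℝ E] [IsManifold 𝓘(ℝ, E) ∞ M] in
lemma mdiffAt_fun_of_contMDiff {f : M → ℝ} (hf : CMDiff ∞ f) (x : M) : MDiffAt f x :=
  (hf x).mdifferentiableAt (by simp)

/-- `[X, Y] f = X (Y f) - Y (X f)`. -/
lemma mvfderiv_mlieBracket [Nontrivial E] [T2Space M] {X Y : Π y : M, TangentSpace 𝓘(ℝ, E) y}
    (hX : CMDiff ∞ (T% X)) (hY : CMDiff ∞ (T% Y)) {f : M → ℝ} (hf : CMDiff ∞ f)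
    (hXf : CMDiff ∞ (fun y => d% f y (X y))) (hYf : CMDiff ∞ (fun y => d% f y (Y y))) (x : M) :
    d% f x (mlieBracket 𝓘(ℝ, E) X Y x) =
      d% (fun y => d% f y (Y y)) x (X x) - d% (fun y => d% f y (X y)) x (Y x) := by
  -- The formula is the coefficient of Z in the Jacobi identity for X, Y, fZ, after subtracting f
  -- times the one for X, Y, Z. It can be read off once Z(x) ≠ 0.
  obtain ⟨e, he⟩ : ∃ e : TangentSpace 𝓘(ℝ, E) x, e ≠ 0 := exists_ne (0 : E)
  obtain ⟨Z, hZ, hZx, -⟩ := exists_contMDiff_eventuallyEq_extend e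
  have hZ0 : Z x ≠ 0 := hZx ▸ he
  have hfZ : CMDiff ∞ (T% (f • Z)) := hf.smul_section hZ
  have h3 : IsManifold 𝓘(ℝ, E) (minSmoothness ℝ 3) M := by
    simp only [minSmoothness_of_isRCLikeNormedField]
    infer_instance
  have h2 : minSmoothness ℝ 2 ≤ (∞ : ℕ∞ω) := by
    simp only [minSmoothness_of_isRCLikeNormedField]
    exact ENat.LEInfty.out
  have jac := leibniz_identity_mlieBracket_apply (I := 𝓘(ℝ, E)) (x := x) (U := X) (V := Y)
    (W := f • Z) ((hX x).of_le h2) ((hY x).of_le h2) ((hfZ x).of_le h2)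
  have jac' := leibniz_identity_mlieBracket_apply (I := 𝓘(ℝ, E)) (x := x) (U := X) (V := Y)
    (W := Z) ((hX x).of_le h2) ((hY x).of_le h2) ((hZ x).of_le h2)
  have md := fun {X : Π y : M, TangentSpace 𝓘(ℝ, E) y} (hX : CMDiff ∞ (T% X)) =>
    mdiffAt_of_contMDiff hX
  have expand : ∀ (X : Π y : M, TangentSpace 𝓘(ℝ, E) y), mlieBracket 𝓘(ℝ, E) X (f • Z) =
      (fun y => d% f y (X y)) • Z + f • mlieBracket 𝓘(ℝ, E) X Z := fun X => by
    ext1 y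
    exact mlieBracket_smul_right (mdiffAt_fun_of_contMDiff hf y) (md hZ y)
  have second : ∀ {X Y : Π y : M, TangentSpace 𝓘(ℝ, E) y}, CMDiff ∞ (T% X) → CMDiff ∞ (T% Y) →
      CMDiff ∞ (fun y => d% f y (Y y)) →
      mlieBracket 𝓘(ℝ, E) X (mlieBracket 𝓘(ℝ, E) Y (f • Z)) x =
        d% (fun y => d% f y (Y y)) x (X x) • Z x + d% f x (Y x) • mlieBracket 𝓘(ℝ, E) X Z x +
        (d% f x (X x) • mlieBracket 𝓘(ℝ, E) Y Z x +
          f x • mlieBracket 𝓘(ℝ, E) X (mlieBracket 𝓘(ℝ, E) Y Z) x) := fun {X Y} hX hY hYf => by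
    have hYZ := contMDiff_mlieBracket hY hZ
    rw [expand Y, mlieBracket_add_right (md (hYf.smul_section hZ) x) (md (hf.smul_section hYZ) x),
      mlieBracket_smul_right (mdiffAt_fun_of_contMDiff hYf x) (md hZ x),
      mlieBracket_smul_right (mdiffAt_fun_of_contMDiff hf x) (md hYZ x)]
  rw [second hX hY hYf, second hY hX hXf, expand] at jac
  change _ = d% f x (mlieBracket 𝓘(ℝ, E) X Y x) • Z x +
    f x • mlieBracket 𝓘(ℝ, E) (mlieBracket 𝓘(ℝ, E) X Y) Z x + _ at jac
  rw [jac'] at jac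
  have h : (d% f x (mlieBracket 𝓘(ℝ, E) X Y x) - (d% (fun y => d% f y (Y y)) x (X x) -
      d% (fun y => d% f y (X y)) x (Y x))) • Z x = 0 := by
    linear_combination (norm := module) (-1 : ℝ) • jac
  exact sub_eq_zero.mp ((smul_eq_zero.mp h).resolve_right hZ0)

/-- The curvature computed on globally smooth vector fields. -/
lemma curvature_eq_of_contMDiff (hcov : CovariantDerivative.ContMDiffCovariantDerivative cov ∞)
    {x : M} {u v w : TangentSpace 𝓘(ℝ, E) x} {X Y Z : Π y : M, TangentSpace 𝓘(ℝ, E) y}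
    (hX : CMDiff ∞ (T% X)) (hY : CMDiff ∞ (T% Y)) (hZ : CMDiff ∞ (T% Z))
    (hXu : ∀ᶠ y in 𝓝 x, X y = FiberBundle.extend E u y)
    (hYv : ∀ᶠ y in 𝓝 x, Y y = FiberBundle.extend E v y)
    (hZw : ∀ᶠ y in 𝓝 x, Z y = FiberBundle.extend E w y) :
    curvature cov x u v w = cov (fun y => cov Z y (Y y)) x (X x)
      - cov (fun y => cov Z y (X y)) x (Y x) - cov Z x (mlieBracket 𝓘(ℝ, E) X Y x) := by
  -- Agreement is needed on a neighbourhood, not just at `x`, because these derivatives are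
  -- differentiated again.
  have hcovZ : ∀ᶠ y in 𝓝 x, cov Z y = cov (FiberBundle.extend E w) y := by
    obtain ⟨s, hs, hsm⟩ := FiberBundle.exists_contMDiffOn_extend (k := ∞) 𝓘(ℝ, E) E w
    filter_upwards [eventually_eventually_nhds.mpr hZw, eventually_mem_nhds_iff.mpr hs]
      with y hy hys
    refine cov.isCovariantDerivativeOnUniv.congr_of_eventuallyEq (mdiffAt_of_contMDiff hZ y)
      ?_ Filter.univ_mem hy
    exact (hsm.contMDiffAt hys).mdifferentiableAt (by simp)
  have inner : ∀ {Y : Π y : M, TangentSpace 𝓘(ℝ, E) y} {v : TangentSpace 𝓘(ℝ, E) x},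
      CMDiff ∞ (T% Y) → (∀ᶠ y in 𝓝 x, Y y = FiberBundle.extend E v y) →
      cov (fun y => cov Z y (Y y)) x =
        cov (fun y => cov (FiberBundle.extend E w) y (FiberBundle.extend E v y)) x :=
      fun {Y v} hY hYv => by
    have hd := mdiffAt_of_contMDiff (contMDiff_cov_apply hcov hY hZ) x
    have he : ∀ᶠ y in 𝓝 x, cov Z y (Y y) =
        cov (FiberBundle.extend E w) y (FiberBundle.extend E v y) := by
      filter_upwards [hcovZ, hYv] with y h1 h2
      rw [h1, h2]
    refine cov.isCovariantDerivativeOnUniv.congr_of_eventuallyEq hd ?_ Filter.univ_mem he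
    refine hd.congr_of_eventuallyEq ?_
    filter_upwards [he] with y hy
    rw [hy]
  unfold curvature
  simp only
  rw [inner hY hYv, inner hX hXu, hcovZ.self_of_nhds, hXu.self_of_nhds, hYv.self_of_nhds,
    Filter.EventuallyEq.mlieBracket_vectorField_eq hXu hYv]

lemma curvature_skew_left (x : M) (u v w : TangentSpace 𝓘(ℝ, E) x) :
    curvature cov x u v w = -curvature cov x v u w := by
  unfold curvature
  simp only
  rw [mlieBracket_swap_apply, map_neg]
  abel

end SmoothFields

section LeviCivita

open VectorField Topology

variable {E : Type*} [NormedAddCommGroup E] [NormedSpace ℝ E] [FiniteDimensional ℝ E]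
  {M : Type*} [TopologicalSpace M] [ChartedSpace E M] [IsManifold 𝓘(ℝ, E) ∞ M]
  [Bundle.RiemannianBundle (fun x : M => TangentSpace 𝓘(ℝ, E) x)]
  [IsContMDiffRiemannianBundle 𝓘(ℝ, E) ∞ E (fun x : M => TangentSpace 𝓘(ℝ, E) x)]
  {cov : CovariantDerivative 𝓘(ℝ, E) E (fun x : M => TangentSpace 𝓘(ℝ, E) x)}

/-! ### Symmetries of the Riemann tensor -/

/-- The vector field `∇_X Y`. -/
def nabla (cov : CovariantDerivative 𝓘(ℝ, E) E (fun x : M => TangentSpace 𝓘(ℝ, E) x))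
    (X Y : Π y : M, TangentSpace 𝓘(ℝ, E) y) (y : M) : TangentSpace 𝓘(ℝ, E) y :=
  cov Y y (X y)

omit [FiniteDimensional ℝ E] in
lemma contMDiff_inner {X Y : Π y : M, TangentSpace 𝓘(ℝ, E) y} (hX : CMDiff ∞ (T% X))
    (hY : CMDiff ∞ (T% Y)) : CMDiff ∞ (fun y => (inner ℝ (X y) (Y y) : ℝ)) :=
  ContMDiff.inner_bundle hX hY

namespace IsLeviCivita

lemma contMDiff_nabla (hcov : IsLeviCivita cov) {X Y : Π y : M, TangentSpace 𝓘(ℝ, E) y}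
    (hX : CMDiff ∞ (T% X)) (hY : CMDiff ∞ (T% Y)) : CMDiff ∞ (T% (nabla cov X Y)) :=
  contMDiff_cov_apply hcov.smooth hX hY

lemma nabla_sub_nabla (hcov : IsLeviCivita cov) {X Y : Π y : M, TangentSpace 𝓘(ℝ, E) y}
    (hX : CMDiff ∞ (T% X)) (hY : CMDiff ∞ (T% Y)) (x : M) :
    nabla cov X Y x - nabla cov Y X x = mlieBracket 𝓘(ℝ, E) X Y x :=
  cov.torsion_eq_zero_iff.mp hcov.torsionFree (mdiffAt_of_contMDiff hX x)
    (mdiffAt_of_contMDiff hY x)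

lemma mvfderiv_inner (hcov : IsLeviCivita cov) {Y Z : Π y : M, TangentSpace 𝓘(ℝ, E) y}
    (hY : CMDiff ∞ (T% Y)) (hZ : CMDiff ∞ (T% Z)) (X : Π y : M, TangentSpace 𝓘(ℝ, E) y) (x : M) :
    d% (fun y => (inner ℝ (Y y) (Z y) : ℝ)) x (X x) =
      inner ℝ (nabla cov X Y x) (Z x) + inner ℝ (Y x) (nabla cov X Z x) :=
  hcov.metric x (X x) Y Z (mdiffAt_of_contMDiff hY x) (mdiffAt_of_contMDiff hZ x)

lemma curvature_bianchi [T2Space M] (hcov : IsLeviCivita cov) (x : M)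
    (u v w : TangentSpace 𝓘(ℝ, E) x) :
    curvature cov x u v w + curvature cov x v w u + curvature cov x w u v = 0 := by
  obtain ⟨X, hX, -, hXu⟩ := exists_contMDiff_eventuallyEq_extend u
  obtain ⟨Y, hY, -, hYv⟩ := exists_contMDiff_eventuallyEq_extend v
  obtain ⟨Z, hZ, -, hZw⟩ := exists_contMDiff_eventuallyEq_extend w
  rw [curvature_eq_of_contMDiff hcov.smooth hX hY hZ hXu hYv hZw,
    curvature_eq_of_contMDiff hcov.smooth hY hZ hX hYv hZw hXu,
    curvature_eq_of_contMDiff hcov.smooth hZ hX hY hZw hXu hYv]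
  have h3 : IsManifold 𝓘(ℝ, E) (minSmoothness ℝ 3) M := by
    simp only [minSmoothness_of_isRCLikeNormedField]
    infer_instance
  have h2 : minSmoothness ℝ 2 ≤ (∞ : ℕ∞ω) := by
    simp only [minSmoothness_of_isRCLikeNormedField]
    exact ENat.LEInfty.out
  have jac := leibniz_identity_mlieBracket_apply (I := 𝓘(ℝ, E)) (x := x) ((hX x).of_le h2)
    ((hY x).of_le h2) ((hZ x).of_le h2)
  -- Two uses of vanishing torsion turn ∇_X(∇_Y Z - ∇_Z Y) - ∇_[Y,Z] X into [X,[Y,Z]]. The cyclic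
  -- sum regroups into three such brackets and vanishes by Jacobi.
  have key : ∀ {X Y Z : Π y : M, TangentSpace 𝓘(ℝ, E) y}, CMDiff ∞ (T% X) → CMDiff ∞ (T% Y) →
      CMDiff ∞ (T% Z) → cov (fun y => cov Z y (Y y)) x (X x) - cov (fun y => cov Y y (Z y)) x (X x)
        - cov X x (mlieBracket 𝓘(ℝ, E) Y Z x) =
          mlieBracket 𝓘(ℝ, E) X (mlieBracket 𝓘(ℝ, E) Y Z) x := fun {X Y Z} hX hY hZ => by
    have hb := contMDiff_mlieBracket hY hZ
    have e : nabla cov Y Z = mlieBracket 𝓘(ℝ, E) Y Z + nabla cov Z Y := by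
      ext1 y
      rw [Pi.add_apply, ← hcov.nabla_sub_nabla hY hZ y]
      abel
    have h1 := hcov.nabla_sub_nabla hX hb x
    have h4 := congrArg (fun W => cov W x (X x)) e
    rw [cov.isCovariantDerivativeOnUniv.add (mdiffAt_of_contMDiff hb x)
      (mdiffAt_of_contMDiff (hcov.contMDiff_nabla hZ hY) x), add_apply] at h4
    change cov (nabla cov Y Z) x (X x) - cov (nabla cov Z Y) x (X x) - _ = _
    rw [← h1, h4]
    unfold nabla
    abel
  have k1 := key hX hY hZ
  have k2 := key hY hZ hX
  have k3 := key hZ hX hY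
  have s1 := mlieBracket_swap_apply (I := 𝓘(ℝ, E)) (V := mlieBracket 𝓘(ℝ, E) X Y) (W := Z) (x := x)
  have s2 : mlieBracket 𝓘(ℝ, E) Y (mlieBracket 𝓘(ℝ, E) X Z) x =
      -mlieBracket 𝓘(ℝ, E) Y (mlieBracket 𝓘(ℝ, E) Z X) x := by
    rw [mlieBracket_swap (V := X) (W := Z), ← neg_one_smul ℝ (mlieBracket 𝓘(ℝ, E) Z X),
      mlieBracket_const_smul_right (mdiffAt_of_contMDiff (contMDiff_mlieBracket hZ hX) x),
      neg_one_smul]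
  rw [s1, s2, ← k1, ← k2, ← k3] at jac
  rw [← sub_eq_zero] at jac
  rw [← jac]
  abel

/-- XY - YX - [X,Y] kills the function ⟨Z, W⟩. Expanding with metric compatibility, the mixed
first-order terms are symmetric in X, Y and cancel. -/
lemma riem_skew_right [Nontrivial E] [T2Space M] (hcov : IsLeviCivita cov) (x : M)
    (u v w z : TangentSpace 𝓘(ℝ, E) x) : riem cov x u v w z = -riem cov x u v z w := by
  obtain ⟨X, hX, -, hXu⟩ := exists_contMDiff_eventuallyEq_extend u
  obtain ⟨Y, hY, -, hYv⟩ := exists_contMDiff_eventuallyEq_extend v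
  obtain ⟨Z, hZ, hZ0, hZw⟩ := exists_contMDiff_eventuallyEq_extend w
  obtain ⟨W, hW, hW0, hWz⟩ := exists_contMDiff_eventuallyEq_extend z
  unfold riem
  rw [curvature_eq_of_contMDiff hcov.smooth hX hY hZ hXu hYv hZw,
    curvature_eq_of_contMDiff hcov.smooth hX hY hW hXu hYv hWz, ← hZ0, ← hW0]
  have hn := fun {X Y} => hcov.contMDiff_nabla (X := X) (Y := Y)
  have first : ∀ X : Π y : M, TangentSpace 𝓘(ℝ, E) y,
      (fun y => d% (fun y => (inner ℝ (Z y) (W y) : ℝ)) y (X y)) =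
      fun y => inner ℝ (nabla cov X Z y) (W y) + inner ℝ (Z y) (nabla cov X W y) := fun X =>
    funext fun y => hcov.mvfderiv_inner hZ hW X y
  have smooth : ∀ {X : Π y : M, TangentSpace 𝓘(ℝ, E) y}, CMDiff ∞ (T% X) →
      CMDiff ∞ (fun y => d% (fun y => (inner ℝ (Z y) (W y) : ℝ)) y (X y)) := fun {X} hX => by
    rw [first]
    exact (contMDiff_inner (hn hX hZ) hW).add (contMDiff_inner hZ (hn hX hW))
  have second : ∀ {X Y : Π y : M, TangentSpace 𝓘(ℝ, E) y}, CMDiff ∞ (T% X) → CMDiff ∞ (T% Y) →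
      d% (fun y => d% (fun y => (inner ℝ (Z y) (W y) : ℝ)) y (Y y)) x (X x) =
      inner ℝ (nabla cov X (nabla cov Y Z) x) (W x) + inner ℝ (nabla cov Y Z x) (nabla cov X W x)
      + (inner ℝ (nabla cov X Z x) (nabla cov Y W x) +
        inner ℝ (Z x) (nabla cov X (nabla cov Y W) x)) := fun {X Y} hX hY => by
    rw [first, mvfderiv_fun_add
      (mdiffAt_fun_of_contMDiff (contMDiff_inner (hn hY hZ) hW) x)
      (mdiffAt_fun_of_contMDiff (contMDiff_inner hZ (hn hY hW)) x), add_apply,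
      hcov.mvfderiv_inner (hn hY hZ) hW, hcov.mvfderiv_inner hZ (hn hY hW)]
  have comm := mvfderiv_mlieBracket hX hY (contMDiff_inner hZ hW) (smooth hX) (smooth hY) x
  rw [second hX hY, second hY hX, hcov.mvfderiv_inner hZ hW (mlieBracket 𝓘(ℝ, E) X Y)] at comm
  unfold nabla at comm
  simp only [inner_sub_left]
  rw [real_inner_comm _ (Z x), real_inner_comm _ (Z x), real_inner_comm _ (Z x)] at comm
  linarith

lemma isCurvatureLike_riem [Nontrivial E] [T2Space M] (hcov : IsLeviCivita cov) (x : M) :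
    IsCurvatureLike (riem cov x) where
  skew_left u v w z := by
    unfold riem
    rw [curvature_skew_left, inner_neg_left]
  skew_right u v w z := hcov.riem_skew_right x u v w z
  bianchi u v w z := by
    unfold riem
    rw [← inner_add_left, ← inner_add_left, hcov.curvature_bianchi, inner_zero_left]

end IsLeviCivita

end LeviCivita

section NearlyKahlerIdentities

open VectorField Topology

variable {E : Type*} [NormedAddCommGroup E] [NormedSpace ℝ E] [FiniteDimensional ℝ E]
  {M : Type*} [TopologicalSpace M] [ChartedSpace E M] [IsManifold 𝓘(ℝ, E) ∞ M]
  [Bundle.RiemannianBundle (fun x : M => TangentSpace 𝓘(ℝ, E) x)]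
  [IsContMDiffRiemannianBundle 𝓘(ℝ, E) ∞ E (fun x : M => TangentSpace 𝓘(ℝ, E) x)]
  {cov : CovariantDerivative 𝓘(ℝ, E) E (fun x : M => TangentSpace 𝓘(ℝ, E) x)}
  {S : SU3Structure E M}

/-! ### The curvature acting on `ω` and `ψ⁺` -/

namespace SU3Structure

lemma contMDiff_omega (S : SU3Structure E M) {X Y : Π y : M, TangentSpace 𝓘(ℝ, E) y}
    (hX : CMDiff ∞ (T% X)) (hY : CMDiff ∞ (T% Y)) :
    CMDiff ∞ (fun y => S.omega y (X y) (Y y)) :=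
  contMDiff_inner (fun x => S.smooth_J x X (hX x)) hY

omit [FiniteDimensional ℝ E]
  [IsContMDiffRiemannianBundle 𝓘(ℝ, E) ∞ E (fun x : M => TangentSpace 𝓘(ℝ, E) x)] in
lemma contMDiff_psiPlus (S : SU3Structure E M) {X Y Z : Π y : M, TangentSpace 𝓘(ℝ, E) y}
    (hX : CMDiff ∞ (T% X)) (hY : CMDiff ∞ (T% Y)) (hZ : CMDiff ∞ (T% Z)) :
    CMDiff ∞ (fun y => S.psiPlus y (X y) (Y y) (Z y)) :=
  fun x => S.smooth_psiPlus x X Y Z (hX x) (hY x) (hZ x)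

end SU3Structure

namespace IsNearlyKahler

omit [IsContMDiffRiemannianBundle 𝓘(ℝ, E) ∞ E (fun x : M => TangentSpace 𝓘(ℝ, E) x)] in
lemma mvfderiv_omega (hS : IsNearlyKahler cov S) {Y Z : Π y : M, TangentSpace 𝓘(ℝ, E) y}
    (hY : CMDiff ∞ (T% Y)) (hZ : CMDiff ∞ (T% Z)) (X : Π y : M, TangentSpace 𝓘(ℝ, E) y) (x : M) :
    d% (fun y => S.omega y (Y y) (Z y)) x (X x) =
      S.omega x (nabla cov X Y x) (Z x) + S.omega x (Y x) (nabla cov X Z x) -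
        S.psiPlus x (X x) (Y x) (Z x) := by
  have := hS.nabla_omega x (X x) Y Z (mdiffAt_of_contMDiff hY x) (mdiffAt_of_contMDiff hZ x)
  unfold nabla
  linarith

omit [IsContMDiffRiemannianBundle 𝓘(ℝ, E) ∞ E (fun x : M => TangentSpace 𝓘(ℝ, E) x)] in
lemma mvfderiv_psiPlus (hS : IsNearlyKahler cov S) {Y Z W : Π y : M, TangentSpace 𝓘(ℝ, E) y}
    (hY : CMDiff ∞ (T% Y)) (hZ : CMDiff ∞ (T% Z)) (hW : CMDiff ∞ (T% W))
    (X : Π y : M, TangentSpace 𝓘(ℝ, E) y) (x : M) :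
    d% (fun y => S.psiPlus y (Y y) (Z y) (W y)) x (X x) =
      S.psiPlus x (nabla cov X Y x) (Z x) (W x) + S.psiPlus x (Y x) (nabla cov X Z x) (W x) +
        S.psiPlus x (Y x) (Z x) (nabla cov X W x) +
        (inner ℝ (X x) (Y x) * S.omega x (Z x) (W x) + inner ℝ (X x) (Z x) * S.omega x (W x) (Y x)
        + inner ℝ (X x) (W x) * S.omega x (Y x) (Z x)) := by
  have := hS.nabla_psiPlus x (X x) Y Z W (mdiffAt_of_contMDiff hY x) (mdiffAt_of_contMDiff hZ x)
    (mdiffAt_of_contMDiff hW x)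
  unfold nabla
  linarith

/-- The Ricci identity: the second derivative of `ω` comes from ∇ψ⁺, while the undifferentiated ψ⁺
terms cancel by vanishing torsion. The right side is the action of the sphere's curvature on `ω`. -/
lemma curvature_omega [Nontrivial E] [T2Space M] (hcov : IsLeviCivita cov)
    (hS : IsNearlyKahler cov S) (x : M) (u v w z : TangentSpace 𝓘(ℝ, E) x) :
    S.omega x (curvature cov x u v w) z + S.omega x w (curvature cov x u v z) =
      inner ℝ u w * S.omega x z v + inner ℝ u z * S.omega x v w -
        (inner ℝ v w * S.omega x z u + inner ℝ v z * S.omega x u w) := by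
  obtain ⟨X, hX, hX0, hXu⟩ := exists_contMDiff_eventuallyEq_extend u
  obtain ⟨Y, hY, hY0, hYv⟩ := exists_contMDiff_eventuallyEq_extend v
  obtain ⟨Z, hZ, hZ0, hZw⟩ := exists_contMDiff_eventuallyEq_extend w
  obtain ⟨W, hW, hW0, hWz⟩ := exists_contMDiff_eventuallyEq_extend z
  rw [curvature_eq_of_contMDiff hcov.smooth hX hY hZ hXu hYv hZw,
    curvature_eq_of_contMDiff hcov.smooth hX hY hW hXu hYv hWz, ← hX0, ← hY0, ← hZ0, ← hW0]
  have hn := fun {X Y} => hcov.contMDiff_nabla (X := X) (Y := Y)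
  have md := fun {f : M → ℝ} (hf : CMDiff ∞ f) => mdiffAt_fun_of_contMDiff hf x
  have mdadd : ∀ {f g : M → ℝ}, MDiffAt f x → MDiffAt g x → MDiffAt (fun y => f y + g y) x :=
    fun hf hg => hf.add hg
  have first : ∀ X : Π y : M, TangentSpace 𝓘(ℝ, E) y,
      (fun y => d% (fun y => S.omega y (Z y) (W y)) y (X y)) =
      fun y => S.omega y (nabla cov X Z y) (W y) + S.omega y (Z y) (nabla cov X W y) -
        S.psiPlus y (X y) (Z y) (W y) := fun X =>
    funext fun y => hS.mvfderiv_omega hZ hW X y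
  have smooth : ∀ {X : Π y : M, TangentSpace 𝓘(ℝ, E) y}, CMDiff ∞ (T% X) →
      CMDiff ∞ (fun y => d% (fun y => S.omega y (Z y) (W y)) y (X y)) := fun {X} hX => by
    rw [first]
    exact ((S.contMDiff_omega (hn hX hZ) hW).add (S.contMDiff_omega hZ (hn hX hW))).sub
      (S.contMDiff_psiPlus hX hZ hW)
  have second : ∀ {X Y : Π y : M, TangentSpace 𝓘(ℝ, E) y}, CMDiff ∞ (T% X) → CMDiff ∞ (T% Y) →
      d% (fun y => d% (fun y => S.omega y (Z y) (W y)) y (Y y)) x (X x) = _ :=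
      fun {X Y} hX hY => by
    rw [first, mvfderiv_fun_sub
        (mdadd (md (S.contMDiff_omega (hn hY hZ) hW)) (md (S.contMDiff_omega hZ (hn hY hW))))
        (md (S.contMDiff_psiPlus hY hZ hW)),
      mvfderiv_fun_add (md (S.contMDiff_omega (hn hY hZ) hW))
        (md (S.contMDiff_omega hZ (hn hY hW))), sub_apply, add_apply,
      hS.mvfderiv_omega (hn hY hZ) hW, hS.mvfderiv_omega hZ (hn hY hW),
      hS.mvfderiv_psiPlus hY hZ hW]
  have comm := mvfderiv_mlieBracket hX hY (S.contMDiff_omega hZ hW) (smooth hX) (smooth hY) x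
  rw [second hX hY, second hY hX, hS.mvfderiv_omega hZ hW (mlieBracket 𝓘(ℝ, E) X Y),
    ← hcov.nabla_sub_nabla hX hY] at comm
  rw [← hcov.nabla_sub_nabla hX hY]
  have e : mlieBracket 𝓘(ℝ, E) X Y = fun y => nabla cov X Y y - nabla cov Y X y :=
    funext fun y => (hcov.nabla_sub_nabla hX hY y).symm
  rw [e] at comm
  -- The terms ⟨X, Y⟩ ω(Z, W) from the two orders of differentiation must match in order to cancel.
  rw [real_inner_comm (Y x) (X x)] at comm
  unfold nabla at comm ⊢
  simp only [map_sub, LinearMap.sub_apply] at comm ⊢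
  linear_combination -comm

/-- The same computation with the two structure equations exchanged; the right side is the sphere's
curvature acting on ψ⁺. -/
lemma curvature_psiPlus [Nontrivial E] [T2Space M] (hcov : IsLeviCivita cov)
    (hS : IsNearlyKahler cov S) (x : M) (u v a b c : TangentSpace 𝓘(ℝ, E) x) :
    S.psiPlus x (curvature cov x u v a) b c + S.psiPlus x a (curvature cov x u v b) c +
        S.psiPlus x a b (curvature cov x u v c) =
      inner ℝ v a * S.psiPlus x u b c + inner ℝ v b * S.psiPlus x u c a +
          inner ℝ v c * S.psiPlus x u a b -
        (inner ℝ u a * S.psiPlus x v b c + inner ℝ u b * S.psiPlus x v c a +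
          inner ℝ u c * S.psiPlus x v a b) := by
  obtain ⟨X, hX, hX0, hXu⟩ := exists_contMDiff_eventuallyEq_extend u
  obtain ⟨Y, hY, hY0, hYv⟩ := exists_contMDiff_eventuallyEq_extend v
  obtain ⟨A, hA, hA0, hAa⟩ := exists_contMDiff_eventuallyEq_extend a
  obtain ⟨B, hB, hB0, hBb⟩ := exists_contMDiff_eventuallyEq_extend b
  obtain ⟨C, hC, hC0, hCc⟩ := exists_contMDiff_eventuallyEq_extend c
  rw [curvature_eq_of_contMDiff hcov.smooth hX hY hA hXu hYv hAa,
    curvature_eq_of_contMDiff hcov.smooth hX hY hB hXu hYv hBb,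
    curvature_eq_of_contMDiff hcov.smooth hX hY hC hXu hYv hCc,
    ← hX0, ← hY0, ← hA0, ← hB0, ← hC0]
  have hn := fun {X Y} => hcov.contMDiff_nabla (X := X) (Y := Y)
  have md := fun {f : M → ℝ} (hf : CMDiff ∞ f) => mdiffAt_fun_of_contMDiff hf x
  have mdadd : ∀ {f g : M → ℝ}, MDiffAt f x → MDiffAt g x → MDiffAt (fun y => f y + g y) x :=
    fun hf hg => hf.add hg
  have hio : ∀ {X Y Z W : Π y : M, TangentSpace 𝓘(ℝ, E) y}, CMDiff ∞ (T% X) → CMDiff ∞ (T% Y) →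
      CMDiff ∞ (T% Z) → CMDiff ∞ (T% W) →
      CMDiff ∞ (fun y => inner ℝ (X y) (Y y) * S.omega y (Z y) (W y)) := fun hX hY hZ hW =>
    (contMDiff_inner hX hY).mul (S.contMDiff_omega hZ hW)
  have hp := fun {X Y Z} => S.contMDiff_psiPlus (X := X) (Y := Y) (Z := Z)
  have first : ∀ X : Π y : M, TangentSpace 𝓘(ℝ, E) y,
      (fun y => d% (fun y => S.psiPlus y (A y) (B y) (C y)) y (X y)) =
      fun y => S.psiPlus y (nabla cov X A y) (B y) (C y) +
        S.psiPlus y (A y) (nabla cov X B y) (C y) + S.psiPlus y (A y) (B y) (nabla cov X C y) +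
        (inner ℝ (X y) (A y) * S.omega y (B y) (C y) + inner ℝ (X y) (B y) * S.omega y (C y) (A y)
        + inner ℝ (X y) (C y) * S.omega y (A y) (B y)) := fun X =>
    funext fun y => hS.mvfderiv_psiPlus hA hB hC X y
  have smooth : ∀ {X : Π y : M, TangentSpace 𝓘(ℝ, E) y}, CMDiff ∞ (T% X) →
      CMDiff ∞ (fun y => d% (fun y => S.psiPlus y (A y) (B y) (C y)) y (X y)) := fun {X} hX => by
    rw [first]
    exact (((hp (hn hX hA) hB hC).add (hp hA (hn hX hB) hC)).add (hp hA hB (hn hX hC))).add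
      (((hio hX hA hB hC).add (hio hX hB hC hA)).add (hio hX hC hA hB))
  have dio : ∀ {X Y Z W V : Π y : M, TangentSpace 𝓘(ℝ, E) y}, CMDiff ∞ (T% X) →
      CMDiff ∞ (T% Y) → CMDiff ∞ (T% Z) → CMDiff ∞ (T% W) →
      d% (fun y => inner ℝ (X y) (Y y) * S.omega y (Z y) (W y)) x (V x) =
        inner ℝ (X x) (Y x) * (S.omega x (nabla cov V Z x) (W x) +
          S.omega x (Z x) (nabla cov V W x) - S.psiPlus x (V x) (Z x) (W x)) +
        S.omega x (Z x) (W x) * (inner ℝ (nabla cov V X x) (Y x) +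
          inner ℝ (X x) (nabla cov V Y x)) := fun {X Y Z W V} hX hY hZ hW => by
    rw [mvfderiv_fun_mul (md (contMDiff_inner hX hY)) (md (S.contMDiff_omega hZ hW)), add_apply,
      smul_apply, smul_apply, hS.mvfderiv_omega hZ hW, hcov.mvfderiv_inner hX hY, smul_eq_mul,
      smul_eq_mul]
  have second : ∀ {X Y : Π y : M, TangentSpace 𝓘(ℝ, E) y}, CMDiff ∞ (T% X) → CMDiff ∞ (T% Y) →
      d% (fun y => d% (fun y => S.psiPlus y (A y) (B y) (C y)) y (Y y)) x (X x) = _ :=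
      fun {X Y} hX hY => by
    rw [first, mvfderiv_fun_add
        (mdadd (mdadd (md (hp (hn hY hA) hB hC)) (md (hp hA (hn hY hB) hC)))
          (md (hp hA hB (hn hY hC))))
        (mdadd (mdadd (md (hio hY hA hB hC)) (md (hio hY hB hC hA))) (md (hio hY hC hA hB))),
      mvfderiv_fun_add (mdadd (md (hp (hn hY hA) hB hC)) (md (hp hA (hn hY hB) hC)))
        (md (hp hA hB (hn hY hC))),
      mvfderiv_fun_add (md (hp (hn hY hA) hB hC)) (md (hp hA (hn hY hB) hC)),
      mvfderiv_fun_add (mdadd (md (hio hY hA hB hC)) (md (hio hY hB hC hA)))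
        (md (hio hY hC hA hB)),
      mvfderiv_fun_add (md (hio hY hA hB hC)) (md (hio hY hB hC hA)),
      add_apply, add_apply, add_apply, add_apply, add_apply,
      dio hY hA hB hC, dio hY hB hC hA, dio hY hC hA hB,
      hS.mvfderiv_psiPlus (hn hY hA) hB hC, hS.mvfderiv_psiPlus hA (hn hY hB) hC,
      hS.mvfderiv_psiPlus hA hB (hn hY hC)]
  have comm := mvfderiv_mlieBracket hX hY (hp hA hB hC) (smooth hX) (smooth hY) x
  rw [second hX hY, second hY hX, hS.mvfderiv_psiPlus hA hB hC (mlieBracket 𝓘(ℝ, E) X Y),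
    ← hcov.nabla_sub_nabla hX hY] at comm
  rw [← hcov.nabla_sub_nabla hX hY]
  have e : mlieBracket 𝓘(ℝ, E) X Y = fun y => nabla cov X Y y - nabla cov Y X y :=
    funext fun y => (hcov.nabla_sub_nabla hX hY y).symm
  rw [e] at comm
  unfold nabla at comm ⊢
  simp only [map_sub, LinearMap.sub_apply, inner_sub_left] at comm ⊢
  linear_combination -comm

end IsNearlyKahler

end NearlyKahlerIdentities

/-! ### From invariance of `ω` and ψ⁺ to 𝔰𝔲(3)-valued curvature. -/

section AdaptedBasis

variable {V : Type*} [NormedAddCommGroup V] [InnerProductSpace ℝ V]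
  {J : V →ₗ[ℝ] V} {e : OrthonormalBasis (Fin 3 × Fin 2) ℝ V}

/-! ### Consequences at a point -/

lemma isOrthogonalComplex_of_adapted (h0 : ∀ a, J (e (a, 0)) = e (a, 1))
    (h1 : ∀ a, J (e (a, 1)) = -e (a, 0)) : IsOrthogonalComplex J where
  sq u := by
    have : J ∘ₗ J = -LinearMap.id := by
      refine e.toBasis.ext fun ⟨a, i⟩ => ?_
      fin_cases i <;> simp [h0, h1]
    exact LinearMap.congr_fun this u
  inner_map_map u v := by
    have : (innerₗ V).compl₁₂ J J = innerₗ V := by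
      refine e.toBasis.ext fun ⟨a, i⟩ => e.toBasis.ext fun ⟨b, j⟩ => ?_
      fin_cases i <;> fin_cases j <;>
        simp [h0, h1, orthonormal_iff_ite.mp e.orthonormal, Prod.ext_iff]
    exact LinearMap.congr_fun₂ this u v

lemma complexCoord_basis (a b : Fin 3) (i : Fin 2) :
    complexCoord e a (e (b, i)) = if a = b then (if i = 0 then 1 else Complex.I) else 0 := by
  fin_cases i <;>
    by_cases h : a = b <;>
      simp [complexCoord, orthonormal_iff_ite.mp e.orthonormal, Prod.ext_iff, h]

@[simp] lemma complexCoord_re (a : Fin 3) (u : V) :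
    (complexCoord e a u).re = inner ℝ (e (a, 0)) u := by simp [complexCoord]

@[simp] lemma complexCoord_im (a : Fin 3) (u : V) :
    (complexCoord e a u).im = inner ℝ (e (a, 1)) u := by simp [complexCoord]

lemma complexVolume_rotate (u v w : V) : complexVolume e u v w = complexVolume e v w u := by
  simp only [complexVolume, Matrix.det_fin_three, Matrix.of_apply, Matrix.cons_val]
  ring

/-- In this and the next two lemmas one slot of (y₁, x₂, x₃) is freed in turn. The volume form
equals i on that triple, so its real part detects the imaginary part of a complex trace. -/
lemma re_complexVolume_left (w : V) :
    (complexVolume e w (e (1, 0)) (e (2, 0))).re = inner ℝ (e (0, 0)) w := by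
  simp [complexVolume, Matrix.det_fin_three, complexCoord_basis]

lemma re_complexVolume_middle (w : V) :
    (complexVolume e (e (0, 1)) w (e (2, 0))).re = -inner ℝ (e (1, 1)) w := by
  simp [complexVolume, Matrix.det_fin_three, complexCoord_basis]

lemma re_complexVolume_right (w : V) :
    (complexVolume e (e (0, 1)) (e (1, 0)) w).re = -inner ℝ (e (2, 1)) w := by
  simp [complexVolume, Matrix.det_fin_three, complexCoord_basis]

/-- If the curvature operators `T u v` act on `ω` and `ψ⁺` as those of the unit sphere, then `T`
differs from the curvature of the unit sphere by a tensor of Calabi–Yau type. -/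
lemma isCalabiYauType_of_adapted [FiniteDimensional ℝ V] (h0 : ∀ a, J (e (a, 0)) = e (a, 1))
    (h1 : ∀ a, J (e (a, 1)) = -e (a, 0)) {T : V → V → V → V}
    {K : V →ₗ[ℝ] V →ₗ[ℝ] V →ₗ[ℝ] V →ₗ[ℝ] ℝ} (hK : IsCurvatureLike (fun u v w z => K u v w z))
    (hT : ∀ u v w z, inner ℝ (T u v w) z = K u v w z + sphereTensor u v w z)
    (hω : ∀ u v w z, fundamentalForm J (T u v w) z + fundamentalForm J w (T u v z) =
      inner ℝ u w * fundamentalForm J z v + inner ℝ u z * fundamentalForm J v w -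
        (inner ℝ v w * fundamentalForm J z u + inner ℝ v z * fundamentalForm J u w))
    {ψ : V → V → V → ℝ} (hψ : ∀ u v w, ψ u v w = (complexVolume e u v w).re)
    (hTψ : ∀ u v a b c, ψ (T u v a) b c + ψ a (T u v b) c + ψ a b (T u v c) =
      inner ℝ v a * ψ u b c + inner ℝ v b * ψ u c a + inner ℝ v c * ψ u a b -
        (inner ℝ u a * ψ v b c + inner ℝ u b * ψ v c a + inner ℝ u c * ψ v a b)) :
    IsCalabiYauType J K where
  curvatureLike := hK
  map_map_right u v w z := by
    have hJ := isOrthogonalComplex_of_adapted h0 h1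
    -- With Jw inserted, the left side pairs K(u,v,Jw,Jz) with K(u,v,z,w), and the sphere terms
    -- cancel against the right side.
    have h := hω u v (J w) z
    simp only [fundamentalForm, LinearMap.comp_apply, innerₗ_apply_apply, hJ.sq,
      hJ.inner_map_left, inner_neg_left, inner_neg_right] at h
    have swap : ∀ x y, (inner ℝ x (J y) : ℝ) = -inner ℝ y (J x) := fun x y => by
      rw [real_inner_comm, hJ.inner_map_left]
    rw [hT, real_inner_comm (T u v z) w, hT, swap z v, swap z u] at h
    simp only [sphereTensor] at h
    have := hK.skew_right u v w z
    linarith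
  trace_right u v := by
    have hJ := isOrthogonalComplex_of_adapted h0 h1
    -- On this triple a skew endomorphism A acts on ψ⁺ by -∑ ⟨A x_a, y_a⟩, so after the sphere terms
    -- cancel, the identity says that the J-trace of `K` vanishes.
    have h := hTψ u v (e (0, 1)) (e (1, 0)) (e (2, 0))
    have rot : ∀ u v w, ψ u v w = ψ v w u := fun u v w => by
      rw [hψ, hψ, complexVolume_rotate]
    have r1 : ∀ w, ψ w (e (1, 0)) (e (2, 0)) = inner ℝ (e (0, 0)) w := fun w => by
      rw [hψ, re_complexVolume_left]
    have r2 : ∀ w, ψ (e (0, 1)) w (e (2, 0)) = -inner ℝ (e (1, 1)) w := fun w => by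
      rw [hψ, re_complexVolume_middle]
    have r3 : ∀ w, ψ (e (0, 1)) (e (1, 0)) w = -inner ℝ (e (2, 1)) w := fun w => by
      rw [hψ, re_complexVolume_right]
    have r2' : ∀ w, ψ w (e (2, 0)) (e (0, 1)) = -inner ℝ (e (1, 1)) w := fun w => by
      rw [← rot, r2]
    have r3' : ∀ w, ψ w (e (0, 1)) (e (1, 0)) = -inner ℝ (e (2, 1)) w := fun w => by
      rw [rot, r3]
    simp only [r1, r2, r3, r2', r3', real_inner_comm (T _ _ _), hT, sphereTensor,
      real_inner_comm u (e _), real_inner_comm v (e _)] at h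
    have s := sum_apply_apply_eq (stdOrthonormalBasis ℝ V) e ((K u v).compl₂ J)
    simp only [LinearMap.compl₂_apply] at s
    rw [s, Fintype.sum_prod_type]
    simp only [Fin.sum_univ_two, Fin.sum_univ_three, h0, h1, map_neg]
    have k := fun a => hK.skew_right u v (e (a, 0)) (e (a, 1))
    have k0 := k 0
    have k1 := k 1
    have k2 := k 2
    linarith

lemma IsSpherePlus.hatOp_mem_lambda28 [FiniteDimensional ℝ V]
    {R K : V →ₗ[ℝ] V →ₗ[ℝ] V →ₗ[ℝ] V →ₗ[ℝ] ℝ} (hR : IsSpherePlus R K) (hK : IsCalabiYauType J K)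
    {β : LinearMap.BilinForm ℝ V} (hβ : β ∈ lambda28 J) :
    hatOp (fun u v w z => R u v w z) β ∈ lambda28 J := by
  have h : hatOp (fun u v w z => R u v w z) β =
      hatOp (fun u v w z => K u v w z) β + (-2 : ℝ) • β := by
    rw [hR.hatOp_eq hβ.1]
    ext u v
    simp only [LinearMap.sub_apply, LinearMap.add_apply, LinearMap.smul_apply, smul_eq_mul]
    ring
  rw [h]
  exact (lambda28 J).add_mem (hK.hatOp_mem_lambda28 β) ((lambda28 J).smul_mem _ hβ)

end AdaptedBasis

/-! ### Splitting the Riemann tensor into sphere and Calabi–Yau parts. -/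

section Decomposition

variable {E : Type*} [NormedAddCommGroup E] [NormedSpace ℝ E] [FiniteDimensional ℝ E]
  {M : Type*} [TopologicalSpace M] [ChartedSpace E M] [IsManifold 𝓘(ℝ, E) ∞ M]
  [Bundle.RiemannianBundle (fun x : M => TangentSpace 𝓘(ℝ, E) x)]
  [IsContMDiffRiemannianBundle 𝓘(ℝ, E) ∞ E (fun x : M => TangentSpace 𝓘(ℝ, E) x)]
  {cov : CovariantDerivative 𝓘(ℝ, E) E (fun x : M => TangentSpace 𝓘(ℝ, E) x)}
  {S : SU3Structure E M}

omit [FiniteDimensional ℝ E]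
  [IsContMDiffRiemannianBundle 𝓘(ℝ, E) ∞ E (fun x : M => TangentSpace 𝓘(ℝ, E) x)] in
lemma SU3Structure.isOrthogonalComplex (S : SU3Structure E M) (x : M) :
    IsOrthogonalComplex (S.J x) := by
  obtain ⟨e, h0, h1, -⟩ := S.adapted x
  exact isOrthogonalComplex_of_adapted h0 h1

/-- The curvature of a nearly Kähler six-manifold is that of the unit sphere plus a tensor of
Calabi–Yau type. -/
theorem IsNearlyKahler.exists_riem_eq [Nontrivial E] [T2Space M] (hcov : IsLeviCivita cov)
    (hS : IsNearlyKahler cov S) (x : M) :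
    ∃ R K : TangentSpace 𝓘(ℝ, E) x →ₗ[ℝ] TangentSpace 𝓘(ℝ, E) x →ₗ[ℝ]
      TangentSpace 𝓘(ℝ, E) x →ₗ[ℝ] TangentSpace 𝓘(ℝ, E) x →ₗ[ℝ] ℝ,
      riem cov x = (fun u v w z => R u v w z) ∧ IsSpherePlus R K ∧ IsCalabiYauType (S.J x) K := by
  have hR := hcov.isCurvatureLike_riem x
  have hs := isCurvatureLike_sphereTensor (V := TangentSpace 𝓘(ℝ, E) x)
  have hK : IsCurvatureLike (fun u v w z => riem cov x u v w z - sphereTensor u v w z) :=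
    ⟨fun u v w z => by rw [hR.skew_left, hs.skew_left]; ring,
      fun u v w z => by rw [hR.skew_right, hs.skew_right]; ring,
      fun u v w z => by linarith [hR.bianchi u v w z, hs.bianchi u v w z]⟩
  obtain ⟨e, h0, h1, hψ, -⟩ := S.adapted x
  refine ⟨hR.toMultilinear (fun _ _ _ _ _ => inner_add_right _ _ _)
      (fun _ _ _ _ _ => real_inner_smul_right _ _ _),
    hK.toMultilinear
      (fun u v w z z' => by simp only [riem, sphereTensor, inner_add_right]; ring)
      (fun c u v w z => by simp only [riem, sphereTensor, real_inner_smul_right]; ring),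
    rfl, fun u v w z => ?_, ?_⟩
  · exact (sub_add_cancel (riem cov x u v w z) (sphereTensor u v w z)).symm
  · exact isCalabiYauType_of_adapted h0 h1 (T := curvature cov x) hK
      (fun u v w z => (sub_add_cancel (riem cov x u v w z) (sphereTensor u v w z)).symm)
      (hS.curvature_omega hcov x) hψ (hS.curvature_psiPlus hcov x)

end Decomposition

end NearlyKahler

end

theorem mainTheorem12 {E : Type*} [NormedAddCommGroup E] [NormedSpace ℝ E]
    [FiniteDimensional ℝ E] (hE : Module.finrank ℝ E = 6)
    {M : Type*} [TopologicalSpace M] [T2Space M] [ChartedSpace E M] [IsManifold 𝓘(ℝ, E) ∞ M]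
    [Bundle.RiemannianBundle (fun x : M => TangentSpace 𝓘(ℝ, E) x)]
    [IsContMDiffRiemannianBundle 𝓘(ℝ, E) ∞ E (fun x : M => TangentSpace 𝓘(ℝ, E) x)]
    (cov : CovariantDerivative 𝓘(ℝ, E) E (fun x : M => TangentSpace 𝓘(ℝ, E) x))
    (hcov : NearlyKahler.IsLeviCivita cov)
    (S : NearlyKahler.SU3Structure E M) (hS : NearlyKahler.IsNearlyKahler cov S)
    (δ Δ : ℝ)
    (hsec : ∀ (x : M) (u v : TangentSpace 𝓘(ℝ, E) x), LinearIndependent ℝ ![u, v] →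
      NearlyKahler.sectional (NearlyKahler.riem cov x) u v ∈ Set.Icc δ Δ)
    (x : M) :
    (∀ β ∈ NearlyKahler.lambda28 (S.J x),
      NearlyKahler.hatOp (NearlyKahler.riem cov x) β ∈ NearlyKahler.lambda28 (S.J x)) ∧
    (∀ (μ : ℝ), ∀ β ∈ NearlyKahler.lambda28 (S.J x),
      Module.End.HasEigenvector (NearlyKahler.hatOp (NearlyKahler.riem cov x)) μ β →
      μ ∈ Set.Icc (-4 + (Δ + δ) - 3 * (Δ - δ)) (-4 + (Δ + δ) + 3 * (Δ - δ)) ∩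
        Set.Icc (-(Δ + δ) - 7 / 3 * (Δ - δ)) (-(Δ + δ) + 7 / 3 * (Δ - δ))) ∧
    (∀ h : LinearMap.BilinForm ℝ (TangentSpace 𝓘(ℝ, E) x),
      NearlyKahler.IsSymPlusZero (S.J x) h →
      NearlyKahler.hatOp (NearlyKahler.weyl (NearlyKahler.riem cov x))
          (NearlyKahler.diamond h (S.omega x)) =
        (2 : ℝ) • NearlyKahler.diamond
          (NearlyKahler.ringOp (NearlyKahler.weyl (NearlyKahler.riem cov x)) h) (S.omega x)) := by
  have : Nontrivial E := Module.nontrivial_of_finrank_pos (R := ℝ) (by omega)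
  obtain ⟨R, K, hRK, hR, hK⟩ := hS.exists_riem_eq hcov x
  have hJ := S.isOrthogonalComplex x
  have hV : Module.finrank ℝ (TangentSpace 𝓘(ℝ, E) x) = 6 := hE
  have hp : NearlyKahler.IsPinched R δ Δ := NearlyKahler.isPinched_of_sectional fun u v h =>
    hRK ▸ hsec x u v h
  rw [hRK]
  refine ⟨fun β hβ => ?_, fun μ β hβ hμ => ?_, fun h _ => ?_⟩
  · exact hR.hatOp_mem_lambda28 hK hβ
  · exact NearlyKahler.eigenvalue_mem_Icc hR hK hJ hV hp hβ hμ
  · rw [hR.weyl_eq hK hJ hV]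
    exact hK.hatOp_diamond hJ h
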